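/- A \emph{vertex ring} is an abelian group $V$ with biadditive products $(u,v)\mapsto u_nv$ ($n\in\mathbb Z$) and a vacuum vector $\mathbf 1$ satisfying regularity ($u_nv=0$ for $n\gg 0$), creation ($v_n\mathbf 1=0$ for $n\ge 0$, $v_{-1}\mathbf 1=v$) and the Jacobi identity. It is \emph{commutative} if it equals its centre, i.e. if all operators $u_m$, $v_n$ commute; it is then a commutative ring with product $rs=r_{-1}s$ and unit $\mathbf 1$, and $D_j(r)=r_{-j-1}\mathbf 1$ is its canonical Hasse--Schmidt derivation. For a commutative vertex ring $R$, an \emph{$R$-vertex algebra} is a vertex ring $V$ with a vertex ring homomorphism $\iota\colon R\to V$ into the centre of $V$; it is an $R$-module via $rv=\iota(r)_{-1}v$. A (commutative) \emph{extension} $S/R$ is an $R$-vertex algebra $S$ that is commutative as a vertex ring. For such $S$ and an $R$-vertex algebra $V$, the tensor product $V\otimes_RS$ is an $S$-vertex algebra under $(u\otimes s)_n(v\otimes t)=\sum_{j\ge0}u_{n+j}v\otimes D_j(s)t$, with vacuum $\mathbf 1\otimes 1$ and structure map $s\mapsto \mathbf 1\otimes s$. An \emph{$S/R$-form} of $V$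 is an $R$-vertex algebra $W$ such that $W\otimes_RS\cong V\otimes_RS$ as $S$-vertex algebras. $\mathbf{Aut}(V)$ is the group functor $A\mapsto \mathrm{Aut}_{A}(V\otimes_RA)$ (automorphisms of $A$-vertex algebras) on commutative $R$-vertex algebras. For a group functor $\mathbf G$ on commutative $R$-vertex algebras, let $d^0(a)=1\otimes a$, $d^1(a)=a\otimes1$ be the maps $S\to S\otimes_RS$, and let $d^0(a\otimes b)=1\otimes a\otimes b$, $d^1(a\otimes b)=a\otimes 1\otimes b$, $d^2(a\otimes b)=a\otimes b\otimes 1$ be the maps $S\otimes_RS\to S\otimes_RS\otimes_RS$; the maps induced on $\mathbf G$ are denoted in the same way. Let $Z^1(S/R,\mathbf G)$ be the set of $\varphi\in\mathbf G(S\otimes_RS)$ with $d^1\varphi=(d^0\varphi)(d^2\varphi)$, and let $H^1(S/R,\mathbf G)$ be its quotient by the equivalence relation $\varphi\sim(d^0g)\,\varphi\,(d^1g)^{-1}$, $g\in\mathbf G(S)$, with distinguished element $1$ the class of the trivial cocycle. \textbf{Theorem.} Let $S/R$ be an extension of commutative vertex rings such that $S$ is faithfully flat as an $R$-module, and let $V$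 be an $R$-vertex algebra. Then there is a bijection from the set of $R$-isomorphism classes of $S/R$-forms of $V$ to $H^1(S/R,\mathbf{Aut}(V))$, which sends the class of $V$ to the distinguished element $1$. It is the usual one: for every $S/R$-form $W$ and every isomorphism $\theta\colon W\otimes_RS\to V\otimes_RS$ of $S$-vertex algebras, the class of $W$ is sent to the class of the cocycle $(d^0\theta)(d^1\theta)^{-1}$, where $d^i\theta$ is the base change of $\theta$ along $d^i\colon S\to S\otimes_RS$. -/

import Mathlib

open scoped TensorProduct

set_option linter.unusedSectionVars false

/-- A vertex ring: an abelian group `V` with biadditive products `uₙ v` (`n ∈ ℤ`), written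
`nprod n u v`, so that `Y(u, z) = ∑ₙ uₙ z⁻ⁿ⁻¹`, and a vacuum vector `vac`, satisfying regularity,
creation (`vₙ 𝟏 = 0` for `n ≥ 0` and `v₋₁ 𝟏 = v`) and the Jacobi identity. The Jacobi identity is
written in components, that is, as the equality of all coefficients of the formal identity
`z₀⁻¹ δ((z₁ - z₂) / z₀) Y(u, z₁) Y(v, z₂) w - z₀⁻¹ δ((z₂ - z₁) / (-z₀)) Y(v, z₂) Y(u, z₁) w =
z₂⁻¹ δ((z₁ - z₀) / z₂) Y(Y(u, z₀) v, z₂) w`. All its sums are finite by regularity. -/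
class VertexRing (V : Type*) [AddCommGroup V] where
  nprod : ℤ → V →+ V →+ V
  vac : V
  regularity : ∀ u v : V, ∃ N : ℤ, ∀ n : ℤ, N ≤ n → nprod n u v = 0
  creation_of_nonneg : ∀ (v : V) (n : ℤ), 0 ≤ n → nprod n v vac = 0
  creation_neg_one : ∀ v : V, nprod (-1) v vac = v
  jacobi : ∀ (u v w : V) (l m n : ℤ),
    ∑ᶠ i : ℕ, Ring.choose m i • nprod (m + n - i) (nprod (l + i) u v) w =
      ∑ᶠ i : ℕ, ((-1) ^ i * Ring.choose l i) •
        (nprod (m + l - i) u (nprod (n + i) v w) -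
          (l.negOnePow : ℤ) • nprod (n + l - i) v (nprod (m + i) u w))

namespace VertexRing

theorem finsum_nat_eq_sum_range {M : Type*} [AddCommMonoid M] {f : ℕ → M} (N : ℕ)
    (h : ∀ i, N ≤ i → f i = 0) : ∑ᶠ i, f i = ∑ i ∈ Finset.range N, f i := by
  apply finsum_eq_sum_of_support_subset
  intro i hi
  simp only [Finset.coe_range, Set.mem_Iio]
  by_contra hc
  exact hi (h i (not_lt.mp hc))

theorem sum_range_antidiagonal {M : Type*} [AddCommMonoid M] (f : ℕ → ℕ → M) (N A B : ℕ)
    (hA : N ≤ A) (hB : N ≤ B) (h : ∀ p q, N ≤ p + q → f p q = 0) :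
    ∑ k ∈ Finset.range N, ∑ x ∈ Finset.HasAntidiagonal.antidiagonal k, f x.1 x.2 =
      ∑ p ∈ Finset.range A, ∑ q ∈ Finset.range B, f p q := by
  rw [← Finset.sum_product', Finset.sum_sigma']
  refine Finset.sum_of_injOn (fun x => x.2) ?_ ?_ ?_ ?_
  · rintro ⟨k, p, q⟩ h1 ⟨k', p', q'⟩ h2 h3
    simp at h1 h2 h3
    obtain ⟨rfl, rfl⟩ := h3
    obtain ⟨_, rfl⟩ := h1
    obtain ⟨_, rfl⟩ := h2
    rfl
  · rintro ⟨k, p, q⟩ h1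
    simp at h1 ⊢
    omega
  · rintro ⟨p, q⟩ _ h2
    apply h
    by_contra hc
    apply h2
    exact ⟨⟨p + q, p, q⟩, by simpa using hc, rfl⟩
  · intros; rfl

variable {V : Type*} [AddCommGroup V] [VertexRing V]

theorem exists_nat_bound (u v : V) (n : ℤ) : ∃ N : ℕ, ∀ j : ℕ, N ≤ j → nprod (n + j) u v = 0 := by
  obtain ⟨N, hN⟩ := regularity u v
  exact ⟨(N - n).toNat, fun j hj => hN _ (by omega)⟩

theorem negOnePow_mul_choose_neg (m k : ℕ) :
    ((-1) ^ k * Ring.choose (-(m : ℤ) - 1) k : ℤ) = ((m + k).choose k : ℕ) := by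
  have : -(m:ℤ) - 1 = -((m + 1 : ℕ) : ℤ) := by push_cast; ring
  rw [this, Ring.choose_neg, Units.smul_def, zsmul_eq_mul]
  have h2 : ((m + 1 : ℕ) : ℤ) + k - 1 = ((m + k : ℕ) : ℤ) := by push_cast; ring
  rw [h2, Ring.choose_natCast]
  simp [← mul_assoc, ← mul_pow, Int.negOnePow_def]

theorem comm_formula (u v w : V) (m n : ℤ) :
    ∑ᶠ i : ℕ, Ring.choose m i • nprod (m + n - i) (nprod (i : ℤ) u v) w =
      nprod m u (nprod n v w) - nprod n v (nprod m u w) := by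
  have h := jacobi u v w 0 m n
  simp only [zero_add] at h
  rw [h, finsum_nat_eq_sum_range 1]
  · simp
  · intro i hi
    obtain ⟨k, rfl⟩ : ∃ k, i = k + 1 := ⟨i - 1, by omega⟩
    simp [Ring.choose_zero_succ]

theorem assoc_formula (u v w : V) (l n : ℤ) :
    nprod n (nprod l u v) w =
      ∑ᶠ i : ℕ, ((-1) ^ i * Ring.choose l i) •
        (nprod (l - i) u (nprod (n + i) v w) -
          (l.negOnePow : ℤ) • nprod (n + l - i) v (nprod (i : ℤ) u w)) := by
  have h := jacobi u v w l 0 n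
  simp only [zero_add] at h
  rw [← h, finsum_nat_eq_sum_range 1]
  · simp
  · intro i hi
    obtain ⟨k, rfl⟩ : ∃ k, i = k + 1 := ⟨i - 1, by omega⟩
    simp [Ring.choose_zero_succ]

theorem vac_comm (u w : V) (m n : ℤ) :
    nprod m u (nprod n vac w) = nprod n vac (nprod m u w) := by
  have h := comm_formula u vac w m n
  rw [finsum_nat_eq_sum_range 0] at h
  · rw [Finset.range_zero, Finset.sum_empty] at h; exact sub_eq_zero.mp h.symm
  · intro i _
    rw [creation_of_nonneg _ _ (by omega)]; simp

theorem vac_nprod_nonneg (v : V) (n : ℤ) (hn : 0 ≤ n) : nprod n vac v = 0 := by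
  conv_lhs => rw [← creation_neg_one v]
  rw [← vac_comm, creation_of_nonneg _ _ hn, map_zero]

theorem vac_nprod_neg_one (v : V) : nprod (-1) vac v = v := by
  conv_lhs => rw [← creation_neg_one v]
  rw [← vac_comm, creation_neg_one, creation_neg_one]

theorem vac_nprod_vac (k : ℕ) (hk : 1 ≤ k) : nprod (-(k : ℤ) - 1) (vac : V) vac = 0 := by
  induction k using Nat.strong_induction_on with
  | _ k ih =>
    have h := assoc_formula (vac : V) vac vac (-1) (-(k : ℤ) - 1)
    rw [creation_neg_one, finsum_nat_eq_sum_range (k + 1)] at h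
    · have hc : ∀ i : ℕ, ((-1) ^ i * Ring.choose (-1) i : ℤ) = 1 := fun i => by
        simpa using negOnePow_mul_choose_neg 0 i
      simp only [hc, one_smul, creation_of_nonneg _ _ (Int.natCast_nonneg _), map_zero, smul_zero,
        sub_zero] at h
      obtain ⟨j, rfl⟩ : ∃ j, k = j + 1 := ⟨k - 1, by omega⟩
      rw [Finset.sum_range_succ, Finset.sum_range_succ', Finset.sum_eq_zero] at h
      · simp only [zero_add, Nat.cast_zero, sub_zero, add_zero, vac_nprod_neg_one] at h
        have e1 : (-((j + 1 : ℕ) : ℤ) - 1 + ((j + 1 : ℕ) : ℤ)) = -1 := by ring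
        have e2 : (-1 - ((j + 1 : ℕ) : ℤ)) = -((j + 1 : ℕ) : ℤ) - 1 := by ring
        rw [e1, creation_neg_one, e2] at h
        simpa using h
      · intro i hi
        have hi' := Finset.mem_range.mp hi
        have := ih (j - i) (by omega) (by omega)
        have e : (-((j + 1 : ℕ) : ℤ) - 1 + ((i + 1 : ℕ) : ℤ)) = -((j - i : ℕ) : ℤ) - 1 := by
          push_cast [Nat.cast_sub hi'.le]; ring
        rw [e, this, map_zero]
    · intro i hi
      rw [creation_of_nonneg _ _ (by omega), creation_of_nonneg _ _ (by omega)]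
      simp

theorem vac_nprod_of_ne (v : V) (n : ℤ) (hn : n ≠ -1) : nprod n vac v = 0 := by
  rcases le_or_gt 0 n with h | h
  · exact vac_nprod_nonneg v n h
  · conv_lhs => rw [← creation_neg_one v]
    rw [← vac_comm]
    obtain ⟨k, rfl⟩ : ∃ k : ℕ, n = -(k : ℤ) - 1 := ⟨(-n - 1).toNat, by omega⟩
    rw [vac_nprod_vac k (by omega), map_zero]

variable (V) in
/-- The centre: those `v` with `Y(v, z₁) Y(u, z₂) = Y(u, z₂) Y(v, z₁)` for all `u`. -/
def center : Set V := {v | ∀ (u w : V) (m n : ℤ), nprod m v (nprod n u w) = nprod n u (nprod m v w)}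

theorem nprod_of_mem_center {v : V} (hv : v ∈ center V) (u : V) (n : ℤ) (hn : 0 ≤ n) :
    nprod n v u = 0 := by
  conv_lhs => rw [← creation_neg_one u]
  rw [hv, creation_of_nonneg _ _ hn, map_zero]

theorem nprod_of_mem_center' {v : V} (hv : v ∈ center V) (u : V) (n : ℤ) (hn : 0 ≤ n) :
    nprod n u v = 0 := by
  conv_lhs => rw [← creation_neg_one v]
  rw [← hv, creation_of_nonneg _ _ hn, map_zero]

theorem mem_center_iff (v : V) :
    v ∈ center V ↔ ∀ (u : V) (n : ℤ), 0 ≤ n → nprod n v u = 0 ∧ nprod n u v = 0 := by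
  refine ⟨fun h u n hn => ⟨nprod_of_mem_center h u n hn, nprod_of_mem_center' h u n hn⟩, ?_⟩
  intro h u w m n
  have h2 := comm_formula v u w m n
  rw [finsum_nat_eq_sum_range 0] at h2
  · rw [Finset.range_zero, Finset.sum_empty] at h2; exact sub_eq_zero.mp h2.symm
  · intro i _
    rw [(h u i (by omega)).1]; simp

/-- The canonical Hasse-Schmidt derivation `Dₘ(v) = v₋ₘ₋₁ 𝟏`. -/
def hasse (m : ℕ) : V →+ V := (nprod (-(m : ℤ) - 1)).flip vac

theorem hasse_apply (m : ℕ) (v : V) : hasse m v = nprod (-(m : ℤ) - 1) v vac := rfl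

@[simp] theorem hasse_zero (v : V) : hasse 0 v = v := by
  simp [hasse_apply, creation_neg_one]

theorem hasse_vac (m : ℕ) (hm : 1 ≤ m) : hasse m (vac : V) = 0 := vac_nprod_vac m hm

theorem hasse_hasse (k m : ℕ) (v : V) :
    hasse k (hasse m v) = (k + m).choose k • hasse (k + m) v := by
  rw [hasse_apply, hasse_apply, assoc_formula, finsum_nat_eq_sum_range (k + 1)]
  · rw [Finset.sum_range_succ, Finset.sum_eq_zero]
    · rw [creation_of_nonneg v _ (Int.natCast_nonneg _)]
      have : (-(k : ℤ) - 1 + k) = -1 := by ring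
      rw [this, creation_neg_one, negOnePow_mul_choose_neg, hasse_apply]
      have : -(m : ℤ) - 1 - k = -((k + m : ℕ) : ℤ) - 1 := by push_cast; ring
      rw [this]; simp [add_comm]
    · intro i hi
      rw [Finset.mem_range] at hi
      rw [vac_nprod_of_ne _ _ (by omega), creation_of_nonneg v _ (by omega)]
      simp
  · intro i hi
    rw [vac_nprod_of_ne _ _ (by omega), creation_of_nonneg v _ (by omega)]
    simp

theorem nprod_neg_one_of_mem_center {v : V} (hv : v ∈ center V) (u w : V) (n : ℤ) (N : ℕ)
    (hN : ∀ j : ℕ, N ≤ j → nprod (n + j) u w = 0) :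
    nprod n (nprod (-1) v u) w =
      ∑ i ∈ Finset.range N, nprod (-(i : ℤ) - 1) v (nprod (n + i) u w) := by
  rw [assoc_formula, finsum_nat_eq_sum_range N]
  · refine Finset.sum_congr rfl fun i _ => ?_
    have hc : ((-1) ^ i * Ring.choose (-1) i : ℤ) = 1 := by
      simpa using negOnePow_mul_choose_neg 0 i
    rw [hc, nprod_of_mem_center hv _ _ (Int.natCast_nonneg i)]
    have : (-1 - (i : ℤ)) = -i - 1 := by ring
    simp [this]
  · intro i hi
    rw [nprod_of_mem_center hv _ _ (Int.natCast_nonneg i), hN i hi]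
    simp

theorem hasse_nprod_neg_one (m : ℕ) (v w : V) :
    nprod (-1) (hasse m v) w = nprod (-(m : ℤ) - 1) v w := by
  rw [hasse_apply, assoc_formula, finsum_nat_eq_sum_range 1]
  · have : nprod (-1 + (-(m : ℤ) - 1)) vac (nprod 0 v w) = 0 := vac_nprod_of_ne _ _ (by omega)
    simp [vac_nprod_neg_one, this]
  · intro i hi
    rw [vac_nprod_of_ne _ _ (by omega), vac_nprod_of_ne _ _ (by omega)]
    simp

end VertexRing

open VertexRing in
/-- A commutative vertex ring: a vertex ring that equals its centre. It is carried together with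
the commutative ring structure `r s = r₋₁ s`, `1 = 𝟏` that it determines (every commutative
vertex ring has this structure: `VertexRing.commVertexRingOfCommutative`). -/
class CommVertexRing (R : Type*) [CommRing R] extends VertexRing R where
  mem_center : ∀ r : R, r ∈ VertexRing.center R
  one_eq_vac : (1 : R) = vac
  mul_eq_nprod : ∀ r s : R, r * s = nprod (-1) r s

namespace VertexRing

variable {V : Type*} [AddCommGroup V] [VertexRing V]

theorem nprod_neg_one_comm (h : ∀ v : V, v ∈ center V) (u v : V) :
    nprod (-1) u v = nprod (-1) v u := by
  conv_lhs => rw [← creation_neg_one v]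
  rw [h u, creation_neg_one]

theorem nprod_neg_one_assoc (h : ∀ v : V, v ∈ center V) (u v w : V) :
    nprod (-1) (nprod (-1) u v) w = nprod (-1) u (nprod (-1) v w) := by
  rw [nprod_neg_one_of_mem_center (h u) v w (-1) 1]
  · simp
  · intro j hj
    exact nprod_of_mem_center (h v) w _ (by omega)

variable (V) in
/-- The ring structure of a vertex ring that equals its centre. -/
abbrev commRingOfCommutative (h : ∀ v : V, v ∈ center V) : CommRing V :=
  { (inferInstance : AddCommGroup V) with
    mul := fun u v => nprod (-1) u v
    one := vac
    left_distrib := fun u v w => map_add (nprod (-1) u) v w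
    right_distrib := fun u v w => DFunLike.congr_fun (map_add (nprod (-1)) u v) w
    zero_mul := fun u => DFunLike.congr_fun (map_zero (nprod (-1))) u
    mul_zero := fun u => map_zero (nprod (-1) u)
    mul_assoc := nprod_neg_one_assoc h
    one_mul := vac_nprod_neg_one
    mul_one := creation_neg_one
    mul_comm := nprod_neg_one_comm h }

variable (V) in
/-- A vertex ring that equals its centre is a commutative vertex ring. -/
abbrev commVertexRingOfCommutative (h : ∀ v : V, v ∈ center V) :
    letI := commRingOfCommutative V h
    CommVertexRing V :=
  letI := commRingOfCommutative V h
  { (inferInstance : VertexRing V) with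
    mem_center := h
    one_eq_vac := rfl
    mul_eq_nprod := fun _ _ => rfl }

end VertexRing

namespace CommVertexRing

open VertexRing

variable {R : Type*} [CommRing R] [CommVertexRing R]

theorem nprod_of_nonneg (r s : R) (n : ℤ) (hn : 0 ≤ n) : nprod n r s = 0 :=
  nprod_of_mem_center (mem_center r) s n hn

theorem nprod_neg (r s : R) (k : ℕ) : nprod (-(k : ℤ) - 1) r s = hasse k r * s := by
  rw [mul_eq_nprod, hasse_nprod_neg_one]

theorem hasse_one (k : ℕ) (hk : 1 ≤ k) : hasse k (1 : R) = 0 := by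
  rw [one_eq_vac, hasse_vac k hk]

theorem hasse_mul (k : ℕ) (r s : R) :
    hasse k (r * s) =
      ∑ x ∈ Finset.HasAntidiagonal.antidiagonal k, hasse x.1 r * hasse x.2 s := by
  rw [Finset.Nat.sum_antidiagonal_eq_sum_range_succ (fun i j => hasse i r * hasse j s),
    mul_eq_nprod, hasse_apply, nprod_neg_one_of_mem_center (mem_center r) s vac _ (k + 1)]
  · refine Finset.sum_congr rfl fun i hi => ?_
    rw [Finset.mem_range] at hi
    rw [nprod_neg, hasse_apply _ s]
    have : -(k : ℤ) - 1 + i = -((k - i : ℕ) : ℤ) - 1 := by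
      rw [Nat.cast_sub (by omega)]; ring
    rw [this]
  · intro j hj
    exact creation_of_nonneg _ _ (by omega)

end CommVertexRing

open VertexRing in
/-- A vertex algebra over a commutative vertex ring `R`: a vertex ring `V` with a homomorphism
`ι : R → V` of vertex rings into the centre. It is carried together with the `R`-module structure
`r • v = ι(r)₋₁ v` that it determines, and `ι` is recovered as `ι(r) = r • 𝟏`; every such `ι`
arises (`VertexAlgebra.ofStructureMap`). That `ι` maps `𝟏 = 1` to `𝟏` is `one_smul`. -/
class VertexAlgebra (R V : Type*) [CommRing R] [CommVertexRing R] [AddCommGroup V] [VertexRing V]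
    [Module R V] : Prop where
  nprod_smul_vac : ∀ (r s : R) (n : ℤ),
    (nprod n r s) • (vac : V) = nprod n (r • (vac : V)) (s • (vac : V))
  smul_vac_mem_center : ∀ r : R, r • (vac : V) ∈ center V
  smul_eq_nprod : ∀ (r : R) (v : V), r • v = nprod (-1) (r • (vac : V)) v

namespace VertexAlgebra

open VertexRing CommVertexRing

section

variable {R V : Type*} [CommRing R] [CommVertexRing R] [AddCommGroup V] [VertexRing V]

/-- The `R`-module structure of a vertex ring with a central homomorphism `ι` from `R`. -/
abbrev moduleOfStructureMap (ι : R →+ V) (h1 : ι vac = vac)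
    (hι : ∀ (r s : R) (n : ℤ), ι (nprod n r s) = nprod n (ι r) (ι s))
    (hc : ∀ r, ι r ∈ center V) : Module R V where
  smul r v := nprod (-1) (ι r) v
  one_smul v := by
    change nprod (-1) (ι 1) v = v
    rw [one_eq_vac (R := R), h1, vac_nprod_neg_one]
  mul_smul r s v := by
    change nprod (-1) (ι (r * s)) v = nprod (-1) (ι r) (nprod (-1) (ι s) v)
    rw [mul_eq_nprod, hι, nprod_neg_one_of_mem_center (hc r) (ι s) v (-1) 1]
    · simp
    · intro j hj
      exact nprod_of_mem_center (hc s) v _ (by omega)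
  smul_zero r := map_zero (nprod (-1) (ι r))
  smul_add r := map_add (nprod (-1) (ι r))
  add_smul r s v := by
    change nprod (-1) (ι (r + s)) v = nprod (-1) (ι r) v + nprod (-1) (ι s) v
    simp
  zero_smul v := by
    change nprod (-1) (ι 0) v = 0
    simp

theorem ofStructureMap (ι : R →+ V) (h1 : ι vac = vac)
    (hι : ∀ (r s : R) (n : ℤ), ι (nprod n r s) = nprod n (ι r) (ι s))
    (hc : ∀ r, ι r ∈ center V) :
    letI := moduleOfStructureMap ι h1 hι hc
    VertexAlgebra R V ∧ ∀ r : R, r • (vac : V) = ι r := by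
  let := moduleOfStructureMap ι h1 hι hc
  have h : ∀ r : R, r • (vac : V) = ι r := fun r => creation_neg_one (ι r)
  refine ⟨⟨fun r s n => ?_, fun r => ?_, fun r v => ?_⟩, h⟩
  · rw [h, h, h, hι]
  · rw [h]; exact hc r
  · rw [h]; rfl

end

variable {R V : Type*} [CommRing R] [CommVertexRing R] [AddCommGroup V] [VertexRing V]
  [Module R V] [VertexAlgebra R V]

theorem hasse_smul_vac (r : R) (j : ℕ) : hasse j (r • (vac : V)) = hasse j r • (vac : V) := by
  have h := nprod_smul_vac (V := V) r 1 (-(j : ℤ) - 1)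
  rw [one_smul, one_eq_vac (R := R)] at h
  exact h.symm

theorem nprod_smul (n : ℤ) (r : R) (u v : V) : nprod n u (r • v) = r • nprod n u v := by
  rw [smul_eq_nprod r v, smul_eq_nprod r (nprod n u v), smul_vac_mem_center]

theorem nprod_neg_smul_vac (r : R) (j : ℕ) (v : V) :
    nprod (-(j : ℤ) - 1) (r • (vac : V)) v = hasse j r • v := by
  rw [smul_eq_nprod (hasse j r), ← hasse_smul_vac, hasse_nprod_neg_one]

theorem smul_nprod (n : ℤ) (r : R) (u v : V) (N : ℕ)
    (hN : ∀ j : ℕ, N ≤ j → nprod (n + j) u v = 0) :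
    nprod n (r • u) v = ∑ j ∈ Finset.range N, hasse j r • nprod (n + j) u v := by
  rw [smul_eq_nprod r u, nprod_neg_one_of_mem_center (smul_vac_mem_center r) u v n N hN]
  exact Finset.sum_congr rfl fun i _ => nprod_neg_smul_vac r i _

end VertexAlgebra

/-- A homomorphism of `R`-vertex algebras: an `R`-linear map of vertex rings. Since `ι(r) = r • 𝟏`,
linearity amounts to compatibility with the structure maps `ι`. -/
structure VertexAlgHom (R V W : Type*) [CommRing R] [CommVertexRing R]
    [AddCommGroup V] [VertexRing V] [Module R V] [AddCommGroup W] [VertexRing W] [Module R W]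
    extends V →ₗ[R] W where
  map_vac' : toFun VertexRing.vac = VertexRing.vac
  map_nprod' : ∀ (n : ℤ) (u v : V),
    toFun (VertexRing.nprod n u v) = VertexRing.nprod n (toFun u) (toFun v)

/-- An isomorphism of `R`-vertex algebras. -/
structure VertexAlgEquiv (R V W : Type*) [CommRing R] [CommVertexRing R]
    [AddCommGroup V] [VertexRing V] [Module R V] [AddCommGroup W] [VertexRing W] [Module R W]
    extends V ≃ₗ[R] W where
  map_vac' : toFun VertexRing.vac = VertexRing.vac
  map_nprod' : ∀ (n : ℤ) (u v : V),
    toFun (VertexRing.nprod n u v) = VertexRing.nprod n (toFun u) (toFun v)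

namespace VertexAlgHom

open VertexRing

variable {R U V W : Type*} [CommRing R] [CommVertexRing R]
  [AddCommGroup U] [VertexRing U] [Module R U]
  [AddCommGroup V] [VertexRing V] [Module R V] [AddCommGroup W] [VertexRing W] [Module R W]

theorem toLinearMap_injective :
    Function.Injective (toLinearMap : VertexAlgHom R V W → V →ₗ[R] W) := by
  rintro ⟨f, _, _⟩ ⟨g, _, _⟩ h
  simpa using h

@[ext]
theorem ext {f g : VertexAlgHom R V W} (h : ∀ v, f.toLinearMap v = g.toLinearMap v) : f = g :=
  toLinearMap_injective (LinearMap.ext h)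

theorem map_vac (f : VertexAlgHom R V W) : f.toLinearMap vac = vac := f.map_vac'

theorem map_nprod (f : VertexAlgHom R V W) (n : ℤ) (u v : V) :
    f.toLinearMap (nprod n u v) = nprod n (f.toLinearMap u) (f.toLinearMap v) :=
  f.map_nprod' n u v

theorem map_hasse (f : VertexAlgHom R V W) (n : ℕ) (v : V) :
    f.toLinearMap (hasse n v) = hasse n (f.toLinearMap v) := by
  rw [hasse_apply, map_nprod, map_vac, hasse_apply]

variable (R V) in
/-- The identity. -/
def id : VertexAlgHom R V V where
  toLinearMap := LinearMap.id
  map_vac' := rfl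
  map_nprod' _ _ _ := rfl

/-- Composition. -/
def comp (g : VertexAlgHom R V W) (f : VertexAlgHom R U V) : VertexAlgHom R U W where
  toLinearMap := g.toLinearMap ∘ₗ f.toLinearMap
  map_vac' := by
    change g.toLinearMap (f.toLinearMap vac) = vac
    rw [f.map_vac, g.map_vac]
  map_nprod' n u v := by
    change g.toLinearMap (f.toLinearMap (nprod n u v)) = _
    rw [f.map_nprod, g.map_nprod]
    rfl

end VertexAlgHom

namespace VertexAlgEquiv

open VertexRing

variable {R U V W : Type*} [CommRing R] [CommVertexRing R]
  [AddCommGroup U] [VertexRing U] [Module R U]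
  [AddCommGroup V] [VertexRing V] [Module R V] [AddCommGroup W] [VertexRing W] [Module R W]

theorem toLinearEquiv_injective :
    Function.Injective (toLinearEquiv : VertexAlgEquiv R V W → V ≃ₗ[R] W) := by
  rintro ⟨f, _, _⟩ ⟨g, _, _⟩ h
  simpa using h

@[ext]
theorem ext {f g : VertexAlgEquiv R V W} (h : ∀ v, f.toLinearEquiv v = g.toLinearEquiv v) : f = g :=
  toLinearEquiv_injective (LinearEquiv.ext h)

theorem map_vac (f : VertexAlgEquiv R V W) : f.toLinearEquiv vac = vac := f.map_vac'

theorem map_nprod (f : VertexAlgEquiv R V W) (n : ℤ) (u v : V) :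
    f.toLinearEquiv (nprod n u v) = nprod n (f.toLinearEquiv u) (f.toLinearEquiv v) :=
  f.map_nprod' n u v

/-- The underlying homomorphism. -/
def toHom (f : VertexAlgEquiv R V W) : VertexAlgHom R V W where
  toLinearMap := f.toLinearEquiv.toLinearMap
  map_vac' := f.map_vac'
  map_nprod' := f.map_nprod'

variable (R V) in
/-- The identity. -/
def refl : VertexAlgEquiv R V V where
  toLinearEquiv := LinearEquiv.refl R V
  map_vac' := rfl
  map_nprod' _ _ _ := rfl

/-- The inverse. -/
def symm (f : VertexAlgEquiv R V W) : VertexAlgEquiv R W V where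
  toLinearEquiv := f.toLinearEquiv.symm
  map_vac' := by
    change f.toLinearEquiv.symm vac = vac
    rw [LinearEquiv.symm_apply_eq, f.map_vac]
  map_nprod' n u v := by
    change f.toLinearEquiv.symm (nprod n u v) =
      nprod n (f.toLinearEquiv.symm u) (f.toLinearEquiv.symm v)
    rw [LinearEquiv.symm_apply_eq, f.map_nprod]
    simp

/-- The composite `g ∘ f`. -/
def trans (f : VertexAlgEquiv R U V) (g : VertexAlgEquiv R V W) : VertexAlgEquiv R U W where
  toLinearEquiv := f.toLinearEquiv.trans g.toLinearEquiv
  map_vac' := (g.toHom.comp f.toHom).map_vac'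
  map_nprod' := (g.toHom.comp f.toHom).map_nprod'

/-- An isomorphism from two mutually inverse homomorphisms. -/
def ofInverse (f : VertexAlgHom R V W) (g : VertexAlgHom R W V)
    (h1 : g.comp f = VertexAlgHom.id R V) (h2 : f.comp g = VertexAlgHom.id R W) :
    VertexAlgEquiv R V W where
  toLinearEquiv := LinearEquiv.ofLinearMap f.toLinearMap g.toLinearMap
    (congrArg VertexAlgHom.toLinearMap h2) (congrArg VertexAlgHom.toLinearMap h1)
  map_vac' := f.map_vac'
  map_nprod' := f.map_nprod'

theorem symm_toHom_comp_toHom (f : VertexAlgEquiv R V W) :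
    f.symm.toHom.comp f.toHom = VertexAlgHom.id R V :=
  VertexAlgHom.ext fun v => f.toLinearEquiv.symm_apply_apply v

theorem toHom_comp_symm_toHom (f : VertexAlgEquiv R V W) :
    f.toHom.comp f.symm.toHom = VertexAlgHom.id R W :=
  VertexAlgHom.ext fun v => f.toLinearEquiv.apply_symm_apply v

theorem toHom_injective : Function.Injective (toHom : VertexAlgEquiv R V W → VertexAlgHom R V W) :=
  fun _ _ h => ext fun v => LinearMap.congr_fun (congrArg VertexAlgHom.toLinearMap h) v

/-- The automorphism group, with composition as multiplication. -/
instance instGroup : Group (VertexAlgEquiv R V V) where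
  mul f g := g.trans f
  one := refl R V
  inv f := f.symm
  mul_assoc _ _ _ := rfl
  one_mul _ := rfl
  mul_one _ := rfl
  inv_mul_cancel f := ext fun v => f.toLinearEquiv.symm_apply_apply v

theorem symm_trans_mul_symm_trans (f g h : VertexAlgEquiv R W V) :
    (g.symm.trans h) * (f.symm.trans g) = f.symm.trans h := by
  refine ext fun v => ?_
  change h.toLinearEquiv (g.toLinearEquiv.symm (g.toLinearEquiv _)) = h.toLinearEquiv _
  rw [LinearEquiv.symm_apply_apply]

theorem mul_apply (f g : VertexAlgEquiv R V V) (v : V) :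
    (f * g).toLinearEquiv v = f.toLinearEquiv (g.toLinearEquiv v) := rfl

end VertexAlgEquiv

namespace BaseChange

open VertexRing CommVertexRing VertexAlgebra

variable {R S V : Type*} [CommRing R] [CommVertexRing R] [CommRing S] [CommVertexRing S]
  [Algebra R S] [VertexAlgebra R S] [AddCommGroup V] [VertexRing V] [Module R V]
  [VertexAlgebra R V]

/-- The `R`-linear map `v ↦ ∑ⱼ Dⱼ(s) ⊗ uₙ₊ⱼ v`. -/
noncomputable def opAux (n : ℤ) (s : S) (u : V) : V →ₗ[R] S ⊗[R] V where
  toFun v := ∑ᶠ j : ℕ, hasse j s ⊗ₜ[R] nprod (n + j) u v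
  map_add' v w := by
    obtain ⟨N, hN⟩ := exists_nat_bound u v n
    obtain ⟨M, hM⟩ := exists_nat_bound u w n
    rw [finsum_nat_eq_sum_range (max N M), finsum_nat_eq_sum_range (max N M),
      finsum_nat_eq_sum_range (max N M), ← Finset.sum_add_distrib]
    · simp [TensorProduct.tmul_add]
    all_goals intro i hi
    · rw [hM i (by omega), TensorProduct.tmul_zero]
    · rw [hN i (by omega), TensorProduct.tmul_zero]
    · rw [map_add, hM i (by omega), hN i (by omega), add_zero, TensorProduct.tmul_zero]
  map_smul' r v := by
    obtain ⟨N, hN⟩ := exists_nat_bound u v n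
    rw [finsum_nat_eq_sum_range N, finsum_nat_eq_sum_range N, Finset.smul_sum]
    · simp [nprod_smul]
    all_goals intro i hi
    · rw [hN i hi, TensorProduct.tmul_zero]
    · rw [nprod_smul, hN i hi, smul_zero, TensorProduct.tmul_zero]

theorem opAux_apply (n : ℤ) (s : S) (u v : V) (N : ℕ)
    (hN : ∀ j : ℕ, N ≤ j → nprod (n + j) u v = 0) :
    opAux (R := R) n s u v = ∑ j ∈ Finset.range N, hasse j s ⊗ₜ[R] nprod (n + j) u v :=
  finsum_nat_eq_sum_range N fun i hi => by rw [hN i hi, TensorProduct.tmul_zero]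

theorem opAux_add_left (n : ℤ) (s t : S) (u : V) :
    opAux (R := R) n (s + t) u = opAux n s u + opAux n t u := by
  ext v
  obtain ⟨N, hN⟩ := exists_nat_bound u v n
  rw [LinearMap.add_apply, opAux_apply n _ u v N hN, opAux_apply n _ u v N hN,
    opAux_apply n _ u v N hN, ← Finset.sum_add_distrib]
  simp [TensorProduct.add_tmul]

theorem opAux_add_right (n : ℤ) (s : S) (u w : V) :
    opAux (R := R) n s (u + w) = opAux n s u + opAux n s w := by
  ext v
  obtain ⟨N, hN⟩ := exists_nat_bound u v n
  obtain ⟨M, hM⟩ := exists_nat_bound w v n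
  rw [LinearMap.add_apply, opAux_apply n _ u v (max N M), opAux_apply n _ w v (max N M),
    opAux_apply n _ (u + w) v (max N M), ← Finset.sum_add_distrib]
  · simp [TensorProduct.tmul_add]
  all_goals intro i hi
  · simp [hM i (by omega), hN i (by omega)]
  · exact hM i (by omega)
  · exact hN i (by omega)

theorem opAux_smul (n : ℤ) (r : R) (s : S) (u : V) :
    opAux (R := R) n (r • s) u = opAux n s (r • u) := by
  ext v
  obtain ⟨N, hN⟩ := exists_nat_bound u v n
  have hN' : ∀ k j : ℕ, N ≤ k + j → nprod (n + k + j) u v = 0 := fun k j h => by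
    have := hN (k + j) h
    push_cast at this
    rwa [add_assoc]
  have hN2 : ∀ j : ℕ, N ≤ j → nprod (n + j) (r • u) v = 0 := fun j hj => by
    rw [smul_nprod _ r u v 0 fun k _ => hN' j k (by omega)]
    simp
  have hs : ∀ k : ℕ, hasse k (r • s) =
      ∑ x ∈ Finset.HasAntidiagonal.antidiagonal k, hasse x.1 r • hasse x.2 s := fun k => by
    rw [Algebra.smul_def, hasse_mul]
    refine Finset.sum_congr rfl fun x _ => ?_
    rw [Algebra.algebraMap_eq_smul_one, one_eq_vac (R := S), hasse_smul_vac (R := R) (V := S),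
      ← one_eq_vac (R := S), Algebra.smul_mul_assoc, one_mul]
  rw [opAux_apply n _ u v N hN, opAux_apply n _ _ v N hN2]
  have h1 := sum_range_antidiagonal
    (fun p q => (hasse p r • hasse q s) ⊗ₜ[R] nprod (n + (p + q : ℕ)) u v) N N N le_rfl le_rfl
    (fun p q h => by rw [hN _ h, TensorProduct.tmul_zero])
  calc _ = _ := ?_
    _ = _ := h1
    _ = _ := ?_
  · refine Finset.sum_congr rfl fun k _ => ?_
    rw [hs, TensorProduct.sum_tmul]
    refine Finset.sum_congr rfl fun x hx => ?_
    rw [Finset.HasAntidiagonal.mem_antidiagonal.mp hx]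
  · rw [Finset.sum_comm]
    refine Finset.sum_congr rfl fun q _ => ?_
    rw [smul_nprod _ r u v N fun k hk => hN' q k (by omega), TensorProduct.tmul_sum]
    refine Finset.sum_congr rfl fun p _ => ?_
    rw [TensorProduct.smul_tmul]
    have e : n + ((p + q : ℕ) : ℤ) = n + q + p := by push_cast; ring
    rw [e]

variable (R S V) in
/-- The `n`-th product of the base change `S ⊗ V` (written with the new base on the left), given by
`(s ⊗ u)ₙ (t ⊗ v) = ∑ⱼ Dⱼ(s) t ⊗ uₙ₊ⱼ v`; see `nprod_tmul`. -/
noncomputable def nprod (n : ℤ) : S ⊗[R] V →+ S ⊗[R] V →+ S ⊗[R] V :=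
  TensorProduct.liftAddHom
    { toFun := fun s =>
        { toFun := fun u => (LinearMap.liftBaseChange S (opAux (R := R) n s u)).toAddMonoidHom
          map_zero' := by
            have : opAux (R := R) n s (0 : V) = 0 := by
              ext v
              simpa using opAux_apply (R := R) n s (0 : V) v 0 (by simp)
            rw [this]; ext; simp
          map_add' := fun u w => by
            rw [opAux_add_right]
            ext x; simp [map_add] }
      map_zero' := by
        ext u x
        have : opAux (R := R) n (0 : S) u = 0 := by
          ext v
          obtain ⟨N, hN⟩ := exists_nat_bound u v n
          simpa using opAux_apply (R := R) n (0 : S) u v N hN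
        simp [this]
      map_add' := fun s t => by
        ext u x
        simp [opAux_add_left] }
    fun r s u => by
      simp [opAux_smul]

theorem nprod_tmul' (n : ℤ) (s t : S) (u v : V) :
    nprod R S V n (s ⊗ₜ u) (t ⊗ₜ v) = t • opAux (R := R) n s u v := by
  simp [nprod]

theorem nprod_tmul_right (n : ℤ) (s t : S) (u : V) (x : S ⊗[R] V) :
    nprod R S V n (s ⊗ₜ u) (t • x) = t • nprod R S V n (s ⊗ₜ u) x := by
  simp [nprod]

theorem nprod_tmul (n : ℤ) (s t : S) (u v : V) (N : ℕ)
    (hN : ∀ j : ℕ, N ≤ j → VertexRing.nprod (n + j) u v = 0) :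
    nprod R S V n (s ⊗ₜ u) (t ⊗ₜ v) =
      ∑ j ∈ Finset.range N, (hasse j s * t) ⊗ₜ[R] VertexRing.nprod (n + j) u v := by
  rw [nprod_tmul', opAux_apply n s u v N hN, Finset.smul_sum]
  simp [TensorProduct.smul_tmul', mul_comm]

end BaseChange

namespace BaseChange

open VertexRing CommVertexRing VertexAlgebra

/-- The Jacobi identity for given elements. -/
def Jac {M : Type*} [AddCommGroup M] (P : ℤ → M →+ M →+ M) (u v w : M) : Prop :=
  ∀ l m n : ℤ, ∑ᶠ i : ℕ, Ring.choose m i • P (m + n - i) (P (l + i) u v) w =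
      ∑ᶠ i : ℕ, ((-1) ^ i * Ring.choose l i) •
        (P (m + l - i) u (P (n + i) v w) - (l.negOnePow : ℤ) • P (n + l - i) v (P (m + i) u w))

theorem jac_iff {M : Type*} [AddCommGroup M] (P : ℤ → M →+ M →+ M) (u v w : M) (l m n : ℤ)
    (N : ℕ) (h1 : ∀ j : ℕ, N ≤ j → P (l + j) u v = 0) (h2 : ∀ j : ℕ, N ≤ j → P (n + j) v w = 0)
    (h3 : ∀ j : ℕ, N ≤ j → P (m + j) u w = 0) :
    (∑ᶠ i : ℕ, Ring.choose m i • P (m + n - i) (P (l + i) u v) w =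
      ∑ᶠ i : ℕ, ((-1) ^ i * Ring.choose l i) •
        (P (m + l - i) u (P (n + i) v w) - (l.negOnePow : ℤ) • P (n + l - i) v (P (m + i) u w))) ↔
    (∑ i ∈ Finset.range N, Ring.choose m i • P (m + n - i) (P (l + i) u v) w =
      ∑ i ∈ Finset.range N, ((-1) ^ i * Ring.choose l i) •
        (P (m + l - i) u (P (n + i) v w) -
          (l.negOnePow : ℤ) • P (n + l - i) v (P (m + i) u w))) := by
  rw [finsum_nat_eq_sum_range N, finsum_nat_eq_sum_range N]
  · intro i hi
    simp [h2 i hi, h3 i hi]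
  · intro i hi
    simp [h1 i hi]

section

variable {M : Type*} [AddCommGroup M] {P : ℤ → M →+ M →+ M}

theorem bound_nat (hP : ∀ u v : M, ∃ N : ℤ, ∀ n : ℤ, N ≤ n → P n u v = 0) (u v : M) (n : ℤ) :
    ∃ N : ℕ, ∀ j : ℕ, N ≤ j → P (n + j) u v = 0 := by
  obtain ⟨N, hN⟩ := hP u v
  exact ⟨(N - n).toNat, fun j hj => hN _ (by omega)⟩

theorem jac_add (hP : ∀ u v : M, ∃ N : ℤ, ∀ n : ℤ, N ≤ n → P n u v = 0) {u u' v v' w w' : M} :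
    (Jac P u v w → Jac P u' v w → Jac P (u + u') v w) ∧
    (Jac P u v w → Jac P u v' w → Jac P u (v + v') w) ∧
    (Jac P u v w → Jac P u v w' → Jac P u v (w + w')) := by
  refine ⟨?_, ?_, ?_⟩
  · intro h h' l m n
    obtain ⟨N1, hN1⟩ := bound_nat hP u v l
    obtain ⟨N2, hN2⟩ := bound_nat hP u' v l
    obtain ⟨N3, hN3⟩ := bound_nat hP v w n
    obtain ⟨N4, hN4⟩ := bound_nat hP u w m
    obtain ⟨N5, hN5⟩ := bound_nat hP u' w m
    have e := (jac_iff P u v w l m n (N1 + N2 + N3 + N4 + N5) (fun j hj => hN1 j (by omega))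
      (fun j hj => hN3 j (by omega)) (fun j hj => hN4 j (by omega))).mp (h l m n)
    have e' := (jac_iff P u' v w l m n (N1 + N2 + N3 + N4 + N5) (fun j hj => hN2 j (by omega))
      (fun j hj => hN3 j (by omega)) (fun j hj => hN5 j (by omega))).mp (h' l m n)
    refine (jac_iff P (u + u') v w l m n (N1 + N2 + N3 + N4 + N5)
      (fun j hj => by simp [hN1 j (by omega), hN2 j (by omega)])
      (fun j hj => hN3 j (by omega))
      (fun j hj => by simp [hN4 j (by omega), hN5 j (by omega)])).mpr ?_
    simp only [map_add, AddMonoidHom.add_apply, smul_add, Finset.sum_add_distrib, e, e']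
    rw [← Finset.sum_add_distrib]
    refine Finset.sum_congr rfl fun i _ => ?_
    module
  · intro h h' l m n
    obtain ⟨N1, hN1⟩ := bound_nat hP u v l
    obtain ⟨N2, hN2⟩ := bound_nat hP u v' l
    obtain ⟨N3, hN3⟩ := bound_nat hP v w n
    obtain ⟨N4, hN4⟩ := bound_nat hP u w m
    obtain ⟨N5, hN5⟩ := bound_nat hP v' w n
    have e := (jac_iff P u v w l m n (N1 + N2 + N3 + N4 + N5) (fun j hj => hN1 j (by omega))
      (fun j hj => hN3 j (by omega)) (fun j hj => hN4 j (by omega))).mp (h l m n)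
    have e' := (jac_iff P u v' w l m n (N1 + N2 + N3 + N4 + N5) (fun j hj => hN2 j (by omega))
      (fun j hj => hN5 j (by omega)) (fun j hj => hN4 j (by omega))).mp (h' l m n)
    refine (jac_iff P u (v + v') w l m n (N1 + N2 + N3 + N4 + N5)
      (fun j hj => by simp [hN1 j (by omega), hN2 j (by omega)])
      (fun j hj => by simp [hN3 j (by omega), hN5 j (by omega)])
      (fun j hj => hN4 j (by omega))).mpr ?_
    simp only [map_add, AddMonoidHom.add_apply, smul_add, Finset.sum_add_distrib, e, e']
    rw [← Finset.sum_add_distrib]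
    refine Finset.sum_congr rfl fun i _ => ?_
    module
  · intro h h' l m n
    obtain ⟨N1, hN1⟩ := bound_nat hP u v l
    obtain ⟨N2, hN2⟩ := bound_nat hP u w' m
    obtain ⟨N3, hN3⟩ := bound_nat hP v w n
    obtain ⟨N4, hN4⟩ := bound_nat hP u w m
    obtain ⟨N5, hN5⟩ := bound_nat hP v w' n
    have e := (jac_iff P u v w l m n (N1 + N2 + N3 + N4 + N5) (fun j hj => hN1 j (by omega))
      (fun j hj => hN3 j (by omega)) (fun j hj => hN4 j (by omega))).mp (h l m n)
    have e' := (jac_iff P u v w' l m n (N1 + N2 + N3 + N4 + N5) (fun j hj => hN1 j (by omega))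
      (fun j hj => hN5 j (by omega)) (fun j hj => hN2 j (by omega))).mp (h' l m n)
    refine (jac_iff P u v (w + w') l m n (N1 + N2 + N3 + N4 + N5)
      (fun j hj => hN1 j (by omega))
      (fun j hj => by simp [hN3 j (by omega), hN5 j (by omega)])
      (fun j hj => by simp [hN2 j (by omega), hN4 j (by omega)])).mpr ?_
    simp only [map_add, smul_add, Finset.sum_add_distrib, e, e']
    rw [← Finset.sum_add_distrib]
    refine Finset.sum_congr rfl fun i _ => ?_
    module

theorem exists_uniform_bound (N : ℕ) (p : ℕ → ℕ → Prop)
    (h : ∀ i, ∃ M, ∀ k, M ≤ k → p i k) : ∃ M, ∀ i, i < N → ∀ k, M ≤ k → p i k := by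
  choose f hf using h
  refine ⟨∑ i ∈ Finset.range N, f i, fun i hi k hk => hf i k (le_trans ?_ hk)⟩
  exact Finset.single_le_sum (f := f) (fun _ _ => Nat.zero_le _) (Finset.mem_range.mpr hi)

theorem sum_range_shift {g : ℕ → M} (j K A : ℕ) (hA : j + K ≤ A) (h1 : ∀ e, e < j → g e = 0)
    (h2 : ∀ e, j + K ≤ e → g e = 0) :
    ∑ e ∈ Finset.range A, g e = ∑ p ∈ Finset.range K, g (p + j) := by
  symm
  refine Finset.sum_of_injOn (fun p => p + j) ?_ ?_ ?_ ?_
  · intro a _ b _ h; simpa using h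
  · intro a ha
    simp at ha ⊢
    omega
  · intro e _ h
    by_cases h3 : e < j
    · exact h1 e h3
    · apply h2
      by_contra hc
      exact h ⟨e - j, by simp; omega, by simp; omega⟩
  · intros; rfl

end

variable {R S V : Type*} [CommRing R] [CommVertexRing R] [CommRing S] [CommVertexRing S]
  [Algebra R S] [VertexAlgebra R S] [AddCommGroup V] [VertexRing V] [Module R V]
  [VertexAlgebra R V]

theorem nprod_regular (x y : S ⊗[R] V) : ∃ N : ℤ, ∀ n : ℤ, N ≤ n → nprod R S V n x y = 0 := by
  induction x with
  | zero => exact ⟨0, by simp⟩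
  | add x x' hx hx' =>
    obtain ⟨N, hN⟩ := hx
    obtain ⟨N', hN'⟩ := hx'
    exact ⟨max N N', fun n hn => by simp [hN n (by omega), hN' n (by omega)]⟩
  | tmul s u =>
    induction y with
    | zero => exact ⟨0, by simp⟩
    | add x x' hx hx' =>
      obtain ⟨N, hN⟩ := hx
      obtain ⟨N', hN'⟩ := hx'
      exact ⟨max N N', fun n hn => by simp [hN n (by omega), hN' n (by omega)]⟩
    | tmul t v =>
      obtain ⟨N, hN⟩ := regularity u v
      exact ⟨N, fun n hn => by
        rw [nprod_tmul n s t u v 0 fun j _ => hN _ (by omega), Finset.sum_range_zero]⟩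

theorem lhs_inner (s t a : S) (x w : V) (j : ℕ) (c : ℤ) (M A B : ℕ) (hA : M ≤ A) (hB : M ≤ B)
    (hM : ∀ k : ℕ, M ≤ k → VertexRing.nprod (c + k) x w = 0) :
    nprod R S V c ((hasse j s * t) ⊗ₜ x) (a ⊗ₜ w) =
      ∑ p ∈ Finset.range A, ∑ q ∈ Finset.range B, ((p + j).choose p : ℤ) •
        ((hasse (p + j) s * hasse q t * a) ⊗ₜ[R] VertexRing.nprod (c + (p + q : ℕ)) x w) := by
  rw [nprod_tmul c _ _ _ _ M hM, ← sum_range_antidiagonal _ M A B hA hB]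
  · refine Finset.sum_congr rfl fun k _ => ?_
    rw [hasse_mul, Finset.sum_mul, TensorProduct.sum_tmul]
    refine Finset.sum_congr rfl fun x hx => ?_
    rw [Finset.HasAntidiagonal.mem_antidiagonal.mp hx, hasse_hasse, natCast_zsmul,
      TensorProduct.smul_tmul', smul_mul_assoc, smul_mul_assoc]
  · intro p q h
    rw [hM _ h, TensorProduct.tmul_zero, smul_zero]

theorem jac_tmul (s t a : S) (u v w : V) : Jac (nprod R S V) (s ⊗ₜ u) (t ⊗ₜ v) (a ⊗ₜ w) := by
  intro l m n
  obtain ⟨N1, hN1⟩ := exists_nat_bound u v l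
  obtain ⟨N2, hN2⟩ := exists_nat_bound v w n
  obtain ⟨N3, hN3⟩ := exists_nat_bound u w m
  obtain ⟨N, hN1', hN2', hN3'⟩ : ∃ N, N1 ≤ N ∧ N2 ≤ N ∧ N3 ≤ N :=
    ⟨N1 + N2 + N3, by omega, by omega, by omega⟩
  have b1 : ∀ i j : ℕ, N ≤ i + j → VertexRing.nprod (l + i + j) u v = 0 := fun i j h => by
    have := hN1 (i + j) (by omega)
    rwa [Nat.cast_add, ← add_assoc] at this
  have b2 : ∀ i j : ℕ, N ≤ i + j → VertexRing.nprod (n + i + j) v w = 0 := fun i j h => by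
    have := hN2 (i + j) (by omega)
    rwa [Nat.cast_add, ← add_assoc] at this
  have b3 : ∀ i j : ℕ, N ≤ i + j → VertexRing.nprod (m + i + j) u w = 0 := fun i j h => by
    have := hN3 (i + j) (by omega)
    rwa [Nat.cast_add, ← add_assoc] at this
  obtain ⟨M1, hM1⟩ := exists_uniform_bound N
    (fun I k => VertexRing.nprod (m + n - N + k) (VertexRing.nprod (l + I) u v) w = 0) (fun I => exists_nat_bound _ _ _)
  obtain ⟨M2, hM2⟩ := exists_uniform_bound N
    (fun I k => VertexRing.nprod (m + l - N + k) u (VertexRing.nprod (n + I) v w) = 0) (fun I => exists_nat_bound _ _ _)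
  obtain ⟨M3, hM3⟩ := exists_uniform_bound N
    (fun I k => VertexRing.nprod (n + l - N + k) v (VertexRing.nprod (m + I) u w) = 0) (fun I => exists_nat_bound _ _ _)
  obtain ⟨M, hM1', hM2', hM3'⟩ : ∃ M, M1 ≤ M ∧ M2 ≤ M ∧ M3 ≤ M :=
    ⟨M1 + M2 + M3, by omega, by omega, by omega⟩
  have c1 : ∀ i j i' k : ℕ, i' ≤ i + j → M ≤ k →
      VertexRing.nprod (m + n - i' + k) (VertexRing.nprod (l + i + j) u v) w = 0 := fun i j i' k hi hk => by
    by_cases h : N ≤ i + j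
    · rw [b1 i j h]; simp
    · have := hM1 (i + j) (by omega) (N - i' + k) (by omega)
      rw [Nat.cast_add, Nat.cast_add, Nat.cast_sub (by omega), ← add_assoc] at this
      rw [show m + n - (i' : ℤ) + k = m + n - N + (N - i') + k by ring, add_assoc l]
      exact this
  have c2 : ∀ i j k : ℕ, M ≤ k →
      VertexRing.nprod (m + l - i + k) u (VertexRing.nprod (n + i + j) v w) = 0 := fun i j k hk => by
    by_cases h : N ≤ i + j
    · rw [b2 i j h]; simp
    · have := hM2 (i + j) (by omega) (N - i + k) (by omega)
      rw [Nat.cast_add, Nat.cast_add, Nat.cast_sub (by omega), ← add_assoc] at this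
      rw [show m + l - (i : ℤ) + k = m + l - N + (N - i) + k by ring, add_assoc n]
      exact this
  have c3 : ∀ i j k : ℕ, M ≤ k →
      VertexRing.nprod (n + l - i + k) v (VertexRing.nprod (m + i + j) u w) = 0 := fun i j k hk => by
    by_cases h : N ≤ i + j
    · rw [b3 i j h]; simp
    · have := hM3 (i + j) (by omega) (N - i + k) (by omega)
      rw [Nat.cast_add, Nat.cast_add, Nat.cast_sub (by omega), ← add_assoc] at this
      rw [show n + l - (i : ℤ) + k = n + l - N + (N - i) + k by ring, add_assoc m]
      exact this
  rw [jac_iff (nprod R S V) _ _ _ l m n N]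
  rotate_left
  · intro j hj
    rw [nprod_tmul _ _ _ _ _ 0 fun k _ => b1 j k (by omega), Finset.sum_range_zero]
  · intro j hj
    rw [nprod_tmul _ _ _ _ _ 0 fun k _ => b2 j k (by omega), Finset.sum_range_zero]
  · intro j hj
    rw [nprod_tmul _ _ _ _ _ 0 fun k _ => b3 j k (by omega), Finset.sum_range_zero]
  -- the common value, first form
  have key1 : ∑ i ∈ Finset.range N, Ring.choose m i •
        nprod R S V (m + n - i) (nprod R S V (l + i) (s ⊗ₜ u) (t ⊗ₜ v)) (a ⊗ₜ w) =
      ∑ e ∈ Finset.range (M + N), ∑ q ∈ Finset.range (M + N), (hasse e s * hasse q t * a) ⊗ₜ[R]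
        ∑ I ∈ Finset.range N, Ring.choose (m + e) I •
          VertexRing.nprod (m + e + (n + q) - I) (VertexRing.nprod (l + I) u v) w := by
    have step1 : ∀ i ∈ Finset.range N, Ring.choose m i •
        nprod R S V (m + n - i) (nprod R S V (l + i) (s ⊗ₜ u) (t ⊗ₜ v)) (a ⊗ₜ w) =
        ∑ j ∈ Finset.range N, ∑ q ∈ Finset.range (M + N), ∑ p ∈ Finset.range M,
          (Ring.choose m i * ((p + j).choose p : ℤ)) •
          ((hasse (p + j) s * hasse q t * a) ⊗ₜ[R]
            VertexRing.nprod (m + n - i + (p + q : ℕ)) (VertexRing.nprod (l + i + j) u v) w) := fun i _ => by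
      rw [nprod_tmul (l + i) s t u v N fun j hj => b1 i j (by omega), map_sum,
        AddMonoidHom.finsetSum_apply, Finset.smul_sum]
      refine Finset.sum_congr rfl fun j _ => ?_
      rw [lhs_inner s t a _ w j (m + n - i) M M (M + N) le_rfl (by omega)
        fun k hk => c1 i j i k (by omega) hk, Finset.sum_comm, Finset.smul_sum]
      refine Finset.sum_congr rfl fun q _ => ?_
      rw [Finset.smul_sum]
      simp only [mul_smul]
    have step2 : ∀ e q : ℕ, ∑ I ∈ Finset.range N, Ring.choose (m + e) I •
          VertexRing.nprod (m + e + (n + q) - I) (VertexRing.nprod (l + I) u v) w =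
        ∑ i ∈ Finset.range N, ∑ j ∈ Finset.range N, (Ring.choose m i * (e.choose j : ℤ)) •
          VertexRing.nprod (m + e + (n + q) - (i + j : ℕ)) (VertexRing.nprod (l + i + j) u v) w := fun e q => by
      rw [← sum_range_antidiagonal _ N N N le_rfl le_rfl]
      · refine Finset.sum_congr rfl fun I _ => ?_
        rw [Ring.add_choose_eq I (Commute.all _ _), Finset.sum_smul]
        refine Finset.sum_congr rfl fun x hx => ?_
        rw [Ring.choose_natCast, add_assoc l, ← Nat.cast_add,
          Finset.HasAntidiagonal.mem_antidiagonal.mp hx]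
      · intro i j h
        rw [b1 i j h]; simp
    simp only [step2, TensorProduct.tmul_sum]
    rw [Finset.sum_congr rfl step1]
    have comm : ∀ F : ℕ → ℕ → ℕ → ℕ → S ⊗[R] V,
        ∑ e ∈ Finset.range (M + N), ∑ q ∈ Finset.range (M + N), ∑ i ∈ Finset.range N,
          ∑ j ∈ Finset.range N, F e q i j =
        ∑ i ∈ Finset.range N, ∑ j ∈ Finset.range N, ∑ q ∈ Finset.range (M + N),
          ∑ e ∈ Finset.range (M + N), F e q i j := fun F => by
      rw [Finset.sum_comm]
      simp only [Finset.sum_comm (s := Finset.range (M + N)) (t := Finset.range N)]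
    rw [comm]
    refine Finset.sum_congr rfl fun i hi => Finset.sum_congr rfl fun j hj =>
      Finset.sum_congr rfl fun q _ => ?_
    rw [Finset.mem_range] at hi hj
    rw [sum_range_shift j M (M + N) (by omega)]
    · refine Finset.sum_congr rfl fun p _ => ?_
      rw [TensorProduct.tmul_smul, Nat.choose_symm_add]
      congr 5
      push_cast; ring
    · intro e he
      rw [Nat.choose_eq_zero_of_lt he]; simp
    · intro e he
      have := c1 i j i (q + (e - j)) (by omega) (by omega)
      rw [Nat.cast_add, Nat.cast_sub (by omega)] at this
      have e1 : m + e + (n + q) - ((i + j : ℕ) : ℤ) = m + n - i + (q + (e - j)) := by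
        push_cast; ring
      rw [e1, this]; simp
  have key2 : ∀ e q : ℕ, ∑ I ∈ Finset.range N, Ring.choose (m + e) I •
          VertexRing.nprod (m + e + (n + q) - I) (VertexRing.nprod (l + I) u v) w =
      ∑ i ∈ Finset.range N, ((-1) ^ i * Ring.choose l i) •
        (VertexRing.nprod (m + e + l - i) u (VertexRing.nprod (n + q + i) v w) -
          (l.negOnePow : ℤ) • VertexRing.nprod (n + q + l - i) v (VertexRing.nprod (m + e + i) u w)) := fun e q => by
    rw [← jac_iff VertexRing.nprod u v w l (m + e) (n + q) N (fun j hj => by simpa using b1 0 j (by omega))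
      (fun j hj => b2 q j (by omega)) (fun j hj => b3 e j (by omega))]
    exact jacobi u v w l (m + e) (n + q)
  rw [key1]
  simp only [key2, TensorProduct.tmul_sum]
  have comm : ∀ F : ℕ → ℕ → ℕ → S ⊗[R] V,
      ∑ e ∈ Finset.range (M + N), ∑ q ∈ Finset.range (M + N), ∑ i ∈ Finset.range N, F e q i =
      ∑ i ∈ Finset.range N, ∑ e ∈ Finset.range (M + N), ∑ q ∈ Finset.range (M + N),
        F e q i := fun F => by
    simp only [Finset.sum_comm (s := Finset.range (M + N)) (t := Finset.range N)]
  rw [comm]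
  refine Finset.sum_congr rfl fun i _ => ?_
  rw [nprod_tmul (n + i) t a v w (M + N) fun j hj => b2 i j (by omega),
    nprod_tmul (m + i) s a u w (M + N) fun j hj => b3 i j (by omega), map_sum, map_sum]
  have r1 : ∀ q : ℕ, nprod R S V (m + l - i) (s ⊗ₜ u) ((hasse q t * a) ⊗ₜ[R] VertexRing.nprod (n + i + q) v w) =
      ∑ e ∈ Finset.range (M + N), (hasse e s * hasse q t * a) ⊗ₜ[R]
        VertexRing.nprod (m + l - i + e) u (VertexRing.nprod (n + i + q) v w) := fun q => by
    rw [nprod_tmul _ _ _ _ _ (M + N) fun k hk => c2 i q k (by omega)]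
    simp only [mul_assoc]
  have r2 : ∀ e : ℕ, nprod R S V (n + l - i) (t ⊗ₜ v) ((hasse e s * a) ⊗ₜ[R] VertexRing.nprod (m + i + e) u w) =
      ∑ q ∈ Finset.range (M + N), (hasse e s * hasse q t * a) ⊗ₜ[R]
        VertexRing.nprod (n + l - i + q) v (VertexRing.nprod (m + i + e) u w) := fun e => by
    rw [nprod_tmul _ _ _ _ _ (M + N) fun k hk => c3 i e k (by omega)]
    refine Finset.sum_congr rfl fun q _ => ?_
    congr 1; ring
  simp only [r1, r2]
  rw [Finset.sum_comm (s := Finset.range (M + N)) (t := Finset.range (M + N))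
      (f := fun q e => (hasse e s * hasse q t * a) ⊗ₜ[R]
        VertexRing.nprod (m + l - i + e) u (VertexRing.nprod (n + i + q) v w)),
    Finset.smul_sum, ← Finset.sum_sub_distrib, Finset.smul_sum]
  refine Finset.sum_congr rfl fun e _ => ?_
  rw [Finset.smul_sum, ← Finset.sum_sub_distrib, Finset.smul_sum]
  refine Finset.sum_congr rfl fun q _ => ?_
  rw [TensorProduct.tmul_smul, TensorProduct.tmul_sub, TensorProduct.tmul_smul]
  have e1 : m + e + l - i = m + l - i + e := by ring
  have e2 : n + q + i = n + i + q := by ring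
  have e3 : n + q + l - i = n + l - i + q := by ring
  have e4 : m + e + i = m + i + e := by ring
  rw [e1, e2, e3, e4]

end BaseChange

namespace BaseChange

open VertexRing CommVertexRing VertexAlgebra

variable {R S T V W : Type*} [CommRing R] [CommVertexRing R] [CommRing S] [CommVertexRing S]
  [Algebra R S] [VertexAlgebra R S] [CommRing T] [CommVertexRing T]
  [Algebra R T] [VertexAlgebra R T] [AddCommGroup V] [VertexRing V] [Module R V]
  [VertexAlgebra R V] [AddCommGroup W] [VertexRing W] [Module R W] [VertexAlgebra R W]

theorem nprod_jac (x y z : S ⊗[R] V) : Jac (nprod R S V) x y z := by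
  have h0 : ∀ x y z : S ⊗[R] V, x = 0 ∨ y = 0 ∨ z = 0 → Jac (nprod R S V) x y z := by
    intro x y z h l m n
    rw [finsum_nat_eq_sum_range 0, finsum_nat_eq_sum_range 0]
    · simp
    all_goals
      intro i _
      rcases h with rfl | rfl | rfl <;> simp
  induction x with
  | zero => exact h0 _ _ _ (Or.inl rfl)
  | add x x' hx hx' => exact (jac_add (v' := 0) (w' := 0) nprod_regular).1 hx hx'
  | tmul s u =>
    induction y with
    | zero => exact h0 _ _ _ (Or.inr (Or.inl rfl))
    | add x x' hx hx' => exact (jac_add (u' := 0) (w' := 0) nprod_regular).2.1 hx hx'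
    | tmul t v =>
      induction z with
      | zero => exact h0 _ _ _ (Or.inr (Or.inr rfl))
      | add x x' hx hx' => exact (jac_add (u' := 0) (v' := 0) nprod_regular).2.2 hx hx'
      | tmul a w => exact jac_tmul s t a u v w

/-- The base change `S ⊗ V`, as a vertex ring. -/
noncomputable instance instVertexRing : VertexRing (S ⊗[R] V) where
  nprod := nprod R S V
  vac := 1 ⊗ₜ vac
  regularity := nprod_regular
  creation_of_nonneg x n hn := by
    induction x with
    | zero => simp
    | add x y hx hy => simp [hx, hy]
    | tmul s u =>
      rw [nprod_tmul n s 1 u vac 0 fun j _ => creation_of_nonneg _ _ (by omega)]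
      simp
  creation_neg_one x := by
    induction x with
    | zero => simp
    | add x y hx hy => simp [hx, hy]
    | tmul s u =>
      rw [nprod_tmul (-1) s 1 u vac 1 fun j _ => creation_of_nonneg _ _ (by omega)]
      simp [creation_neg_one]
  jacobi := nprod_jac

theorem vac_def : (vac : S ⊗[R] V) = 1 ⊗ₜ vac := rfl

theorem nprod_tmul_tmul (n : ℤ) (s t : S) (u v : V) (N : ℕ)
    (hN : ∀ j : ℕ, N ≤ j → VertexRing.nprod (n + j) u v = 0) :
    VertexRing.nprod n (s ⊗ₜ[R] u) (t ⊗ₜ[R] v) =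
      ∑ j ∈ Finset.range N, (hasse j s * t) ⊗ₜ[R] VertexRing.nprod (n + j) u v :=
  nprod_tmul n s t u v N hN

theorem nprod_one_tmul (n : ℤ) (t : S) (u v : V) :
    VertexRing.nprod n ((1 : S) ⊗ₜ[R] u) (t ⊗ₜ[R] v) = t ⊗ₜ VertexRing.nprod n u v := by
  obtain ⟨N, hN⟩ := exists_nat_bound u v n
  rw [nprod_tmul_tmul n 1 t u v (N + 1) fun j hj => hN j (by omega), Finset.sum_range_succ',
    Finset.sum_eq_zero]
  · simp
  · intro j _
    rw [hasse_one _ (by omega)]; simp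

theorem nprod_smul_right (n : ℤ) (t : S) (x y : S ⊗[R] V) :
    VertexRing.nprod n x (t • y) = t • VertexRing.nprod n x y := by
  induction x with
  | zero => simp
  | add x x' hx hx' => simp [hx, hx']
  | tmul s u => exact nprod_tmul_right n s t u y

theorem nprod_tmul_vac (k : ℕ) (s : S) (x : S ⊗[R] V) :
    VertexRing.nprod (-(k : ℤ) - 1) (s ⊗ₜ[R] (vac : V)) x = hasse k s • x := by
  induction x with
  | zero => simp
  | add x x' hx hx' => simp [hx, hx']
  | tmul t v =>
    rw [nprod_tmul_tmul _ s t vac v (k + 1) fun j hj => vac_nprod_of_ne _ _ (by omega),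
      Finset.sum_range_succ, Finset.sum_eq_zero]
    · have : -(k : ℤ) - 1 + k = -1 := by ring
      rw [this, vac_nprod_neg_one, TensorProduct.smul_tmul', smul_eq_mul, zero_add]
    · intro j hj
      rw [Finset.mem_range] at hj
      rw [vac_nprod_of_ne _ _ (by omega), TensorProduct.tmul_zero]

theorem nprod_tmul_vac_of_nonneg (n : ℤ) (hn : 0 ≤ n) (s : S) (x : S ⊗[R] V) :
    VertexRing.nprod n (s ⊗ₜ[R] (vac : V)) x = 0 := by
  induction x with
  | zero => simp
  | add x x' hx hx' => simp [hx, hx']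
  | tmul t v =>
    rw [nprod_tmul_tmul _ s t vac v 0 fun j hj => vac_nprod_of_ne _ _ (by omega)]
    simp

theorem tmul_vac_mem_center (s : S) : s ⊗ₜ[R] (vac : V) ∈ center (S ⊗[R] V) := by
  intro u w m n
  rcases le_or_gt 0 m with hm | hm
  · rw [nprod_tmul_vac_of_nonneg m hm, nprod_tmul_vac_of_nonneg m hm, map_zero]
  · obtain ⟨k, rfl⟩ : ∃ k : ℕ, m = -(k : ℤ) - 1 := ⟨(-m - 1).toNat, by omega⟩
    rw [nprod_tmul_vac, nprod_tmul_vac, nprod_smul_right]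

theorem tmul_vac_nprod (s t : S) (n : ℤ) :
    VertexRing.nprod n s t ⊗ₜ[R] (vac : V) =
      VertexRing.nprod n (s ⊗ₜ[R] (vac : V)) (t ⊗ₜ[R] (vac : V)) := by
  rcases le_or_gt 0 n with hm | hm
  · rw [nprod_tmul_vac_of_nonneg n hm, nprod_of_nonneg _ _ _ hm, TensorProduct.zero_tmul]
  · obtain ⟨k, rfl⟩ : ∃ k : ℕ, n = -(k : ℤ) - 1 := ⟨(-n - 1).toNat, by omega⟩
    rw [nprod_tmul_vac, nprod_neg, TensorProduct.smul_tmul', smul_eq_mul]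

/-- The base change `S ⊗ V` is an `S`-vertex algebra, with `ι(s) = s ⊗ 𝟏`. -/
instance instVertexAlgebra : VertexAlgebra S (S ⊗[R] V) where
  nprod_smul_vac s t n := by
    simp only [vac_def, TensorProduct.smul_tmul', smul_eq_mul, mul_one]
    exact tmul_vac_nprod s t n
  smul_vac_mem_center s := by
    simp only [vac_def, TensorProduct.smul_tmul', smul_eq_mul, mul_one]
    exact tmul_vac_mem_center s
  smul_eq_nprod s x := by
    simp only [vac_def, TensorProduct.smul_tmul', smul_eq_mul, mul_one]
    have := nprod_tmul_vac (R := R) 0 s x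
    simpa using this.symm

/-- An `S`-vertex algebra is an `R`-vertex algebra by restriction of scalars. -/
theorem _root_.VertexAlgebra.restrictScalars (R S V : Type*) [CommRing R] [CommVertexRing R]
    [CommRing S] [CommVertexRing S] [Algebra R S] [VertexAlgebra R S] [AddCommGroup V]
    [VertexRing V] [Module R V] [Module S V] [IsScalarTower R S V] [VertexAlgebra S V] :
    VertexAlgebra R V := by
  have h : ∀ r : R, r • (vac : V) = (r • (vac : S)) • (vac : V) := fun r => by
    rw [← one_eq_vac (R := S), smul_assoc, one_smul]
  refine ⟨fun r s n => ?_, fun r => ?_, fun r v => ?_⟩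
  · rw [h, h, h, ← nprod_smul_vac (R := S), ← nprod_smul_vac (R := R) (V := S) r s n]
  · rw [h]; exact smul_vac_mem_center _
  · rw [h, ← smul_eq_nprod (R := S), ← one_eq_vac (R := S), smul_assoc, one_smul]

instance instVertexAlgebraBase : VertexAlgebra R (S ⊗[R] V) := VertexAlgebra.restrictScalars R S (S ⊗[R] V)

/-- For commutative `T`, the base change `S ⊗ T` is a commutative vertex ring, whose multiplication
is the usual one on a tensor product of algebras. -/
noncomputable instance instCommVertexRing : CommVertexRing (S ⊗[R] T) where
  toVertexRing := inferInstance
  one_eq_vac := by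
    rw [vac_def, Algebra.TensorProduct.one_def, one_eq_vac (R := T)]
  mem_center x := by
    rw [mem_center_iff]
    intro y n hn
    have : ∀ x y : S ⊗[R] T, VertexRing.nprod n x y = 0 := by
      intro x y
      induction x with
      | zero => simp
      | add x x' hx hx' => simp [hx, hx']
      | tmul s u =>
        induction y with
        | zero => simp
        | add x x' hx hx' => simp [hx, hx']
        | tmul t v =>
          rw [nprod_tmul_tmul _ s t u v 0 fun j hj => nprod_of_nonneg _ _ _ (by omega)]
          simp
    exact ⟨this _ _, this _ _⟩
  mul_eq_nprod x y := by
    induction x with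
    | zero => simp
    | add x x' hx hx' => simp [hx, hx', add_mul]
    | tmul s u =>
      induction y with
      | zero => simp
      | add x x' hx hx' => simp [hx, hx', mul_add]
      | tmul t v =>
        rw [nprod_tmul_tmul _ s t u v 1 fun j hj => nprod_of_nonneg _ _ _ (by omega)]
        simp [mul_eq_nprod]

end BaseChange

namespace VertexAlgHom

open VertexRing CommVertexRing VertexAlgebra BaseChange

variable {R S S' T V W U : Type*} [CommRing R] [CommVertexRing R]
  [CommRing S] [CommVertexRing S] [Algebra R S] [VertexAlgebra R S]
  [CommRing S'] [CommVertexRing S'] [Algebra R S'] [VertexAlgebra R S']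
  [CommRing T] [CommVertexRing T] [Algebra R T] [VertexAlgebra R T]
  [AddCommGroup U] [VertexRing U] [Module R U] [VertexAlgebra R U]
  [AddCommGroup V] [VertexRing V] [Module R V] [VertexAlgebra R V]
  [AddCommGroup W] [VertexRing W] [Module R W] [VertexAlgebra R W]

theorem map_mul (f : VertexAlgHom R S T) (s t : S) :
    f.toLinearMap (s * t) = f.toLinearMap s * f.toLinearMap t := by
  rw [mul_eq_nprod, map_nprod, mul_eq_nprod]

theorem map_one (f : VertexAlgHom R S T) : f.toLinearMap 1 = 1 := by
  rw [one_eq_vac (R := S), one_eq_vac (R := T), map_vac]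

/-- The homomorphism `f ⊗ g`. -/
noncomputable def tensorMap (f : VertexAlgHom R S S') (g : VertexAlgHom R V W) :
    VertexAlgHom R (S ⊗[R] V) (S' ⊗[R] W) where
  toLinearMap := TensorProduct.map f.toLinearMap g.toLinearMap
  map_vac' := by
    change TensorProduct.map f.toLinearMap g.toLinearMap (1 ⊗ₜ vac) = 1 ⊗ₜ vac
    rw [TensorProduct.map_tmul, map_one, map_vac]
  map_nprod' n x y := by
    change TensorProduct.map f.toLinearMap g.toLinearMap _ =
      VertexRing.nprod n (TensorProduct.map f.toLinearMap g.toLinearMap x)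
        (TensorProduct.map f.toLinearMap g.toLinearMap y)
    induction x with
    | zero => simp
    | add x x' hx hx' => simp only [map_add, AddMonoidHom.add_apply, hx, hx']
    | tmul s u =>
      induction y with
      | zero => simp
      | add x x' hx hx' => simp only [map_add, hx, hx']
      | tmul t v =>
        obtain ⟨N, hN⟩ := exists_nat_bound u v n
        rw [nprod_tmul_tmul n s t u v N hN, TensorProduct.map_tmul, TensorProduct.map_tmul,
          nprod_tmul_tmul n _ _ _ _ N fun j hj => by rw [← map_nprod, hN j hj, map_zero], map_sum]
        refine Finset.sum_congr rfl fun j _ => ?_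
        rw [TensorProduct.map_tmul, map_mul, map_hasse, map_nprod]

variable (R S V) in
/-- The homomorphism `v ↦ 1 ⊗ v`. -/
noncomputable def inr : VertexAlgHom R V (S ⊗[R] V) where
  toLinearMap := TensorProduct.mk R S V 1
  map_vac' := rfl
  map_nprod' n u v := (nprod_one_tmul n 1 u v).symm

variable (R S T) in
/-- The homomorphism `s ↦ s ⊗ 1`. -/
noncomputable def inl : VertexAlgHom R S (S ⊗[R] T) where
  toLinearMap := (TensorProduct.mk R S T).flip 1
  map_vac' := by
    change (vac : S) ⊗ₜ[R] (1 : T) = 1 ⊗ₜ vac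
    rw [one_eq_vac (R := S), one_eq_vac (R := T)]
  map_nprod' n s t := by
    change _ ⊗ₜ[R] (1 : T) = VertexRing.nprod n (s ⊗ₜ[R] (1 : T)) (t ⊗ₜ[R] (1 : T))
    rw [one_eq_vac (R := T)]
    exact tmul_vac_nprod s t n

/-- Restriction of scalars. -/
def restrictScalars (R : Type*) {S V W : Type*} [CommRing R] [CommVertexRing R] [CommRing S]
    [CommVertexRing S] [Algebra R S] [AddCommGroup V] [VertexRing V] [Module R V] [Module S V]
    [IsScalarTower R S V] [AddCommGroup W] [VertexRing W] [Module R W] [Module S W]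
    [IsScalarTower R S W] (φ : VertexAlgHom S V W) : VertexAlgHom R V W where
  toLinearMap := φ.toLinearMap.restrictScalars R
  map_vac' := φ.map_vac'
  map_nprod' := φ.map_nprod'

/-- The `S`-linear extension `s ⊗ v ↦ s • g(v)` of an `R`-homomorphism `g`. -/
noncomputable def liftBaseChange (S : Type*) [CommRing S] [CommVertexRing S] [Algebra R S]
    [VertexAlgebra R S] [Module S W] [IsScalarTower R S W]
    [VertexAlgebra S W] (g : VertexAlgHom R V W) : VertexAlgHom S (S ⊗[R] V) W where
  toLinearMap := g.toLinearMap.liftBaseChange S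
  map_vac' := by
    change g.toLinearMap.liftBaseChange S (1 ⊗ₜ vac) = vac
    rw [LinearMap.liftBaseChange_tmul, one_smul, map_vac]
  map_nprod' n x y := by
    change g.toLinearMap.liftBaseChange S _ =
      VertexRing.nprod n (g.toLinearMap.liftBaseChange S x) (g.toLinearMap.liftBaseChange S y)
    induction x with
    | zero => simp
    | add x x' hx hx' => simp only [map_add, AddMonoidHom.add_apply, hx, hx']
    | tmul s u =>
      induction y with
      | zero => simp
      | add x x' hx hx' => simp only [map_add, hx, hx']
      | tmul t v =>
        obtain ⟨N, hN⟩ := exists_nat_bound u v n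
        rw [nprod_tmul_tmul n s t u v N hN, LinearMap.liftBaseChange_tmul,
          LinearMap.liftBaseChange_tmul, nprod_smul,
          smul_nprod n s _ _ N fun j hj => by rw [← map_nprod, hN j hj, map_zero], map_sum,
          Finset.smul_sum]
        refine Finset.sum_congr rfl fun j _ => ?_
        rw [LinearMap.liftBaseChange_tmul, map_nprod, mul_comm, mul_smul]

/-- The base change of `φ : S ⊗ V → S ⊗ W` along `f : S → T`, that is, `id_T ⊗_S φ` under the
identification `T ⊗_S (S ⊗ V) = T ⊗ V`. It maps `t ⊗ v` to `t • (f ⊗ id)(φ(1 ⊗ v))`. -/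
noncomputable def baseChange (f : VertexAlgHom R S T) (φ : VertexAlgHom S (S ⊗[R] V) (S ⊗[R] W)) :
    VertexAlgHom T (T ⊗[R] V) (T ⊗[R] W) :=
  liftBaseChange T
    ((tensorMap f (VertexAlgHom.id R W)).comp ((φ.restrictScalars R).comp (inr R S V)))

theorem baseChange_tmul (f : VertexAlgHom R S T) (φ : VertexAlgHom S (S ⊗[R] V) (S ⊗[R] W))
    (t : T) (v : V) : (baseChange f φ).toLinearMap (t ⊗ₜ v) =
      t • (tensorMap f (VertexAlgHom.id R W)).toLinearMap (φ.toLinearMap (1 ⊗ₜ v)) :=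
  LinearMap.liftBaseChange_tmul ..

theorem tensorMap_smul (f : VertexAlgHom R S T) (g : VertexAlgHom R V W) (s : S) (x : S ⊗[R] V) :
    (tensorMap f g).toLinearMap (s • x) = f.toLinearMap s • (tensorMap f g).toLinearMap x := by
  change TensorProduct.map f.toLinearMap g.toLinearMap _ =
    _ • TensorProduct.map f.toLinearMap g.toLinearMap _
  induction x with
  | zero => simp
  | add x y hx hy => simp [hx, hy]
  | tmul t v => simp [TensorProduct.smul_tmul', map_mul]

theorem baseChange_tensorMap (f : VertexAlgHom R S T)
    (φ : VertexAlgHom S (S ⊗[R] V) (S ⊗[R] W)) (x : S ⊗[R] V) :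
    (baseChange f φ).toLinearMap ((tensorMap f (VertexAlgHom.id R V)).toLinearMap x) =
      (tensorMap f (VertexAlgHom.id R W)).toLinearMap (φ.toLinearMap x) := by
  induction x with
  | zero => simp
  | add x y hx hy => simp [hx, hy]
  | tmul s v =>
    have h : (tensorMap f (VertexAlgHom.id R V)).toLinearMap (s ⊗ₜ v) =
      f.toLinearMap s ⊗ₜ v := rfl
    have h2 : s ⊗ₜ[R] v = s • ((1 : S) ⊗ₜ[R] v) := by simp [TensorProduct.smul_tmul']
    rw [h, baseChange_tmul, h2, map_smul, tensorMap_smul]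

theorem ext_tmul {f g : VertexAlgHom S (S ⊗[R] V) (S ⊗[R] W)}
    (h : ∀ v : V, f.toLinearMap (1 ⊗ₜ v) = g.toLinearMap (1 ⊗ₜ v)) : f = g := by
  refine VertexAlgHom.ext fun x => ?_
  induction x with
  | zero => simp
  | add x y hx hy => simp [hx, hy]
  | tmul s v =>
    have h2 : s ⊗ₜ[R] v = s • ((1 : S) ⊗ₜ[R] v) := by simp [TensorProduct.smul_tmul']
    rw [h2, map_smul, map_smul, h]

theorem baseChange_comp (f : VertexAlgHom R S T) (ψ : VertexAlgHom S (S ⊗[R] V) (S ⊗[R] W))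
    (φ : VertexAlgHom S (S ⊗[R] U) (S ⊗[R] V)) :
    baseChange f (ψ.comp φ) = (baseChange f ψ).comp (baseChange f φ) := by
  refine ext_tmul fun v => ?_
  change _ = (baseChange f ψ).toLinearMap ((baseChange f φ).toLinearMap _)
  rw [baseChange_tmul, baseChange_tmul, one_smul, one_smul, baseChange_tensorMap]
  rfl

theorem baseChange_id (f : VertexAlgHom R S T) :
    baseChange f (VertexAlgHom.id S (S ⊗[R] V)) = VertexAlgHom.id T (T ⊗[R] V) := by
  refine ext_tmul fun v => ?_
  rw [baseChange_tmul, one_smul]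
  change f.toLinearMap 1 ⊗ₜ v = 1 ⊗ₜ v
  rw [map_one]

theorem baseChange_id_left (φ : VertexAlgHom S (S ⊗[R] V) (S ⊗[R] W)) :
    baseChange (VertexAlgHom.id R S) φ = φ := by
  refine ext_tmul fun v => ?_
  rw [baseChange_tmul, one_smul]
  change TensorProduct.map LinearMap.id LinearMap.id _ = _
  rw [TensorProduct.map_id, LinearMap.id_apply]

theorem baseChange_comp_left (f : VertexAlgHom R S S') (g : VertexAlgHom R S' T)
    (φ : VertexAlgHom S (S ⊗[R] V) (S ⊗[R] W)) :
    baseChange (g.comp f) φ = baseChange g (baseChange f φ) := by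
  refine ext_tmul fun v => ?_
  rw [baseChange_tmul, baseChange_tmul, baseChange_tmul, one_smul, one_smul, one_smul]
  change TensorProduct.map (g.toLinearMap ∘ₗ f.toLinearMap) (LinearMap.id ∘ₗ LinearMap.id) _ = _
  rw [TensorProduct.map_comp]
  rfl

end VertexAlgHom

namespace VertexAlgEquiv

variable {R S T V W U : Type*} [CommRing R] [CommVertexRing R]
  [CommRing S] [CommVertexRing S] [Algebra R S] [VertexAlgebra R S]
  [CommRing T] [CommVertexRing T] [Algebra R T] [VertexAlgebra R T]
  [AddCommGroup V] [VertexRing V] [Module R V] [VertexAlgebra R V]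
  [AddCommGroup W] [VertexRing W] [Module R W] [VertexAlgebra R W]

/-- The base change of an isomorphism along `f : S → T`. -/
noncomputable def baseChange (f : VertexAlgHom R S T)
    (φ : VertexAlgEquiv S (S ⊗[R] V) (S ⊗[R] W)) : VertexAlgEquiv T (T ⊗[R] V) (T ⊗[R] W) :=
  ofInverse (VertexAlgHom.baseChange f φ.toHom) (VertexAlgHom.baseChange f φ.symm.toHom)
    (by rw [← VertexAlgHom.baseChange_comp, symm_toHom_comp_toHom, VertexAlgHom.baseChange_id])
    (by rw [← VertexAlgHom.baseChange_comp, toHom_comp_symm_toHom, VertexAlgHom.baseChange_id])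

theorem toHom_baseChange (f : VertexAlgHom R S T) (φ : VertexAlgEquiv S (S ⊗[R] V) (S ⊗[R] W)) :
    (VertexAlgEquiv.baseChange f φ).toHom = VertexAlgHom.baseChange f φ.toHom := rfl

theorem baseChange_symm_trans {T' : Type*} [CommRing T'] [CommVertexRing T'] [Algebra R T']
    [VertexAlgebra R T'] (f₀ f₁ : VertexAlgHom R S T) (g : VertexAlgHom R T T')
    (θ : VertexAlgEquiv S (S ⊗[R] W) (S ⊗[R] V)) :
    VertexAlgEquiv.baseChange g
        ((VertexAlgEquiv.baseChange f₁ θ).symm.trans (VertexAlgEquiv.baseChange f₀ θ)) =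
      (VertexAlgEquiv.baseChange (g.comp f₁) θ).symm.trans
        (VertexAlgEquiv.baseChange (g.comp f₀) θ) := by
  apply toHom_injective
  have h : ((VertexAlgEquiv.baseChange f₁ θ).symm.trans (VertexAlgEquiv.baseChange f₀ θ)).toHom =
      (VertexAlgHom.baseChange f₀ θ.toHom).comp (VertexAlgHom.baseChange f₁ θ.symm.toHom) := rfl
  have h' : ((VertexAlgEquiv.baseChange (g.comp f₁) θ).symm.trans
      (VertexAlgEquiv.baseChange (g.comp f₀) θ)).toHom =
      (VertexAlgHom.baseChange (g.comp f₀) θ.toHom).comp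
        (VertexAlgHom.baseChange (g.comp f₁) θ.symm.toHom) := rfl
  rw [toHom_baseChange, h, h', VertexAlgHom.baseChange_comp, VertexAlgHom.baseChange_comp_left,
    VertexAlgHom.baseChange_comp_left]

end VertexAlgEquiv

/-- The category `R-cva` of commutative `R`-vertex algebras. -/
structure CommVertexAlgCat.{u, r} (R : Type r) [CommRing R] [CommVertexRing R] where
  of ::
  carrier : Type u
  [commRing : CommRing carrier]
  [commVertexRing : CommVertexRing carrier]
  [algebra : Algebra R carrier]
  [vertexAlgebra : VertexAlgebra R carrier]

attribute [instance] CommVertexAlgCat.commRing CommVertexAlgCat.commVertexRing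
  CommVertexAlgCat.algebra CommVertexAlgCat.vertexAlgebra

namespace CommVertexAlgCat

variable {R : Type*} [CommRing R] [CommVertexRing R]

instance instCategory : CategoryTheory.Category (CommVertexAlgCat R) where
  Hom A B := VertexAlgHom R A.carrier B.carrier
  id A := VertexAlgHom.id R A.carrier
  comp f g := g.comp f

end CommVertexAlgCat

namespace VertexDescent

section Cohomology

universe u r w

variable (R : Type r) [CommRing R] [CommVertexRing R]
  (S : Type u) [CommRing S] [CommVertexRing S] [Algebra R S] [VertexAlgebra R S]

open VertexAlgHom

/-- The coface maps `d⁰(a) = 1 ⊗ a` and `d¹(a) = a ⊗ 1` from `S` to `S ⊗ S`. -/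
noncomputable def face₁ (i : Fin 2) :
    CommVertexAlgCat.of (R := R) S ⟶ CommVertexAlgCat.of (S ⊗[R] S) :=
  match i with
  | 0 => inr R S S
  | 1 => inl R S S

/-- The coface maps from `S ⊗ S` to `S ⊗ S ⊗ S`: `d⁰(a ⊗ b) = 1 ⊗ a ⊗ b`, `d¹(a ⊗ b) = a ⊗ 1 ⊗ b` and
`d²(a ⊗ b) = a ⊗ b ⊗ 1`. -/
noncomputable def face₂ (i : Fin 3) :
    CommVertexAlgCat.of (R := R) (S ⊗[R] S) ⟶ CommVertexAlgCat.of (S ⊗[R] (S ⊗[R] S)) :=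
  match i with
  | 0 => inr R S (S ⊗[R] S)
  | 1 => tensorMap (VertexAlgHom.id R S) (inr R S S)
  | 2 => tensorMap (VertexAlgHom.id R S) (inl R S S)

variable (G : CategoryTheory.Functor (CommVertexAlgCat.{u} R) GrpCat.{w})

/-- The set `Z¹(S/R, G)` of `φ ∈ G(S ⊗ S)` with `d¹φ = d⁰φ · d²φ`. -/
def Cocycle : Type w :=
  {φ : G.obj (.of (S ⊗[R] S)) //
    (G.map (face₂ R S 1)).hom φ = (G.map (face₂ R S 0)).hom φ * (G.map (face₂ R S 2)).hom φ}

/-- The trivial cocycle. -/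
noncomputable instance Cocycle.instOne : One (Cocycle R S G) := ⟨⟨1, by simp⟩⟩

/-- Cohomologous cocycles: `ψ = d⁰g · φ · (d¹g)⁻¹` for some `g ∈ G(S)`. -/
def cocycleSetoid : Setoid (Cocycle R S G) where
  r φ ψ := ∃ g : G.obj (.of S),
    ψ.val = (G.map (face₁ R S 0)).hom g * φ.val * ((G.map (face₁ R S 1)).hom g)⁻¹
  iseqv :=
    { refl := fun φ => ⟨1, by simp⟩
      symm := by
        rintro φ ψ ⟨g, hg⟩
        exact ⟨g⁻¹, by simp [hg, mul_assoc]⟩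
      trans := by
        rintro φ ψ χ ⟨g, hg⟩ ⟨h, hh⟩
        exact ⟨h * g, by simp [hg, hh, mul_assoc]⟩ }

/-- The non-abelian cohomology set `H¹(S/R, G)`. -/
def H1 : Type w := Quotient (cocycleSetoid R S G)

/-- The class of a cocycle. -/
def H1.mk (φ : Cocycle R S G) : H1 R S G := Quotient.mk (cocycleSetoid R S G) φ

/-- The distinguished element: the class of the trivial cocycle. -/
noncomputable instance H1.instOne : One (H1 R S G) := ⟨H1.mk R S G 1⟩

end Cohomology

section Forms

universe u r v

variable (R : Type r) [CommRing R] [CommVertexRing R]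
  (S : Type u) [CommRing S] [CommVertexRing S] [Algebra R S] [VertexAlgebra R S]
  (V : Type v) [AddCommGroup V] [VertexRing V] [Module R V] [VertexAlgebra R V]

/-- The group functor `Aut(V)`, with `Aut(V)(A) = Aut_A(A ⊗ V)`. -/
noncomputable def autFunctor :
    CategoryTheory.Functor (CommVertexAlgCat.{u} R) GrpCat.{max u v} where
  obj A := GrpCat.of (VertexAlgEquiv A.carrier (A.carrier ⊗[R] V) (A.carrier ⊗[R] V))
  map {A B} f := GrpCat.ofHom
    { toFun := fun φ => VertexAlgEquiv.baseChange f φ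
      map_one' := VertexAlgEquiv.toHom_injective (VertexAlgHom.baseChange_id f)
      map_mul' := fun φ ψ =>
        VertexAlgEquiv.toHom_injective (VertexAlgHom.baseChange_comp f φ.toHom ψ.toHom) }
  map_id A := by
    refine GrpCat.hom_ext (MonoidHom.ext fun φ => ?_)
    exact VertexAlgEquiv.toHom_injective (VertexAlgHom.baseChange_id_left (VertexAlgEquiv.toHom φ))
  map_comp f g := by
    refine GrpCat.hom_ext (MonoidHom.ext fun φ => ?_)
    exact VertexAlgEquiv.toHom_injective
      (VertexAlgHom.baseChange_comp_left f g (VertexAlgEquiv.toHom φ))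

/-- An `S/R`-form of `V`: an `R`-vertex algebra that becomes isomorphic to `V` over `S`. -/
structure TwistedForm where
  carrier : Type v
  [addCommGroup : AddCommGroup carrier]
  [vertexRing : VertexRing carrier]
  [module : Module R carrier]
  [vertexAlgebra : VertexAlgebra R carrier]
  isForm : Nonempty (VertexAlgEquiv S (S ⊗[R] carrier) (S ⊗[R] V))

attribute [instance] TwistedForm.addCommGroup TwistedForm.vertexRing TwistedForm.module
  TwistedForm.vertexAlgebra

/-- `V` itself, as an `S/R`-form of `V`. -/
def TwistedForm.self : TwistedForm R S V where
  carrier := V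
  isForm := ⟨VertexAlgEquiv.refl S _⟩

/-- `R`-isomorphism of `S/R`-forms. -/
def twistedFormSetoid : Setoid (TwistedForm R S V) where
  r W W' := Nonempty (VertexAlgEquiv R W.carrier W'.carrier)
  iseqv :=
    { refl := fun _ => ⟨VertexAlgEquiv.refl R _⟩
      symm := fun ⟨f⟩ => ⟨f.symm⟩
      trans := fun ⟨f⟩ ⟨g⟩ => ⟨f.trans g⟩ }

/-- The `R`-isomorphism classes of `S/R`-forms of `V`. -/
def FormClasses : Type (max r (v + 1)) := Quotient (twistedFormSetoid R S V)

/-- The `R`-isomorphism class of an `S/R`-form. -/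
def FormClasses.mk (W : TwistedForm R S V) : FormClasses R S V :=
  Quotient.mk (twistedFormSetoid R S V) W

variable {R S V}

/-- The automorphism `d⁰θ ∘ (d¹θ)⁻¹` of `S ⊗ S ⊗ V` attached to a trivialization
`θ : S ⊗ W ≃ S ⊗ V`. -/
noncomputable def transitionAut {W : Type v} [AddCommGroup W] [VertexRing W] [Module R W]
    [VertexAlgebra R W] (θ : VertexAlgEquiv S (S ⊗[R] W) (S ⊗[R] V)) :
    VertexAlgEquiv (S ⊗[R] S) ((S ⊗[R] S) ⊗[R] V) ((S ⊗[R] S) ⊗[R] V) :=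
  (VertexAlgEquiv.baseChange (face₁ R S 1) θ).symm.trans
    (VertexAlgEquiv.baseChange (face₁ R S 0) θ)

theorem baseChange_transitionAut {W : Type v} [AddCommGroup W] [VertexRing W] [Module R W]
    [VertexAlgebra R W] (θ : VertexAlgEquiv S (S ⊗[R] W) (S ⊗[R] V)) :
    VertexAlgEquiv.baseChange (face₂ R S 1) (transitionAut θ) =
      VertexAlgEquiv.baseChange (face₂ R S 0) (transitionAut θ) *
        VertexAlgEquiv.baseChange (face₂ R S 2) (transitionAut θ) := by
  have h01 : VertexAlgHom.comp (face₂ R S 1) (face₁ R S 0) =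
    VertexAlgHom.comp (face₂ R S 0) (face₁ R S 0) := rfl
  have h11 : VertexAlgHom.comp (face₂ R S 1) (face₁ R S 1) =
    VertexAlgHom.comp (face₂ R S 2) (face₁ R S 1) := rfl
  have h02 : VertexAlgHom.comp (face₂ R S 2) (face₁ R S 0) =
    VertexAlgHom.comp (face₂ R S 0) (face₁ R S 1) := rfl
  have h : ∀ i : Fin 3, VertexAlgEquiv.baseChange (face₂ R S i) (transitionAut θ) = _ := fun i =>
    VertexAlgEquiv.baseChange_symm_trans (face₁ R S 0) (face₁ R S 1) (face₂ R S i) θ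
  rw [h, h, h, h01, h11, h02, VertexAlgEquiv.symm_trans_mul_symm_trans]

/-- The cocycle `d⁰θ ∘ (d¹θ)⁻¹` attached to a trivialization `θ : S ⊗ W ≃ S ⊗ V`. -/
noncomputable def transitionCocycle {W : Type v} [AddCommGroup W] [VertexRing W] [Module R W]
    [VertexAlgebra R W] (θ : VertexAlgEquiv S (S ⊗[R] W) (S ⊗[R] V)) :
    Cocycle R S (autFunctor R V) :=
  ⟨transitionAut θ, baseChange_transitionAut θ⟩

end Forms

end VertexDescent

/-! This is faithfully flat descent; the vertex structure is carried along because every map in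
sight is a homomorphism. Write d¹, d⁰ for the pushforwards S ⊗ V → (S ⊗ S) ⊗ V along the two
cofaces. A cocycle φ cuts out W = {x : φ(d¹x) = d⁰x} inside S ⊗ V. Both sides of this equation are
homomorphisms of R-vertex algebras, so W is an R-vertex algebra, and θ : S ⊗ W → S ⊗ V, s ⊗ w ↦ s •
w, is a homomorphism of S-vertex algebras as the S-linear extension of the inclusion. What remains
is the bijectivity of θ, which concerns modules only.

Read Δ(x) = φ(d¹x) in S ⊗ (S ⊗ V); then W consists of the x with Δ(x) = 1 ⊗ x. The cocycle condition
says that id ⊗ (φ ∘ d¹) and id ⊗ d⁰ agree on Δ(x) (`coaction_coassoc`). Multiplying the two copies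
of S sends Δ(x) back to x, since φ restricts to the identity along S ⊗ S → S
(`baseChange_mulHom_of_isCocycle`). By flatness S ⊗ W is the equalizer of id ⊗ (φ ∘ d¹) and id ⊗ d⁰,
so Δ takes values in S ⊗ W and inverts θ (`bijective_liftBaseChange_descendedSubtype`). The equation
that defines W then says φ ∘ d¹θ = d⁰θ, so φ is the cocycle of θ. This gives surjectivity.

The rest is descent of homomorphisms. The trivial cocycle, together with faithful flatness, gives
exactness of V → S ⊗ V ⇉ S ⊗ S ⊗ V (`exists_one_tmul_eq`). Hence an isomorphism S ⊗ W ≃ S ⊗ W' whose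
two base changes to S ⊗ S agree comes from R. If g relates the cocycles of θ and θ', then θ'⁻¹ ∘ g ∘
θ is such an isomorphism, which gives injectivity. Conversely an isomorphism f of forms yields g =
θ' ∘ (id ⊗ f) ∘ θ⁻¹, so the class depends neither on the trivialization nor on the representative.
-/

open VertexRing CommVertexRing in
/-- A commutative vertex ring is a vertex algebra over itself. -/
instance VertexAlgebra.instSelf (R : Type*) [CommRing R] [CommVertexRing R] :
    VertexAlgebra R R where
  nprod_smul_vac r s n := by
    simp only [← one_eq_vac, smul_eq_mul, mul_one]
  smul_vac_mem_center r := mem_center _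
  smul_eq_nprod r s := by
    rw [← one_eq_vac, smul_eq_mul, smul_eq_mul, mul_one, mul_eq_nprod]

/-! ### Equalizers of homomorphisms of vertex algebras. -/

namespace VertexAlgHom

open VertexRing CommVertexRing VertexAlgebra

section EqLocus

variable {R U V W : Type*} [CommRing R] [CommVertexRing R]
  [AddCommGroup U] [VertexRing U] [Module R U]
  [AddCommGroup V] [VertexRing V] [Module R V] [AddCommGroup W] [VertexRing W] [Module R W]

/-- The equalizer of two homomorphisms of `R`-vertex algebras. -/
def EqLocus (f g : VertexAlgHom R V W) : Type _ :=
  LinearMap.eqLocus f.toLinearMap g.toLinearMap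

namespace EqLocus

variable {f g : VertexAlgHom R V W}

instance instAddCommGroup : AddCommGroup (EqLocus f g) :=
  inferInstanceAs (AddCommGroup (LinearMap.eqLocus f.toLinearMap g.toLinearMap))

instance instModule : Module R (EqLocus f g) :=
  inferInstanceAs (Module R (LinearMap.eqLocus f.toLinearMap g.toLinearMap))

theorem apply_val (u : EqLocus f g) : f.toLinearMap u.1 = g.toLinearMap u.1 := u.2

/-- The equalizer is a vertex subring. -/
instance instVertexRing : VertexRing (EqLocus f g) where
  nprod n := AddMonoidHom.mk' (fun u => AddMonoidHom.mk'
      (fun v => ⟨nprod n u.1 v.1, by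
        rw [LinearMap.mem_eqLocus, map_nprod, map_nprod, apply_val, apply_val]⟩)
      fun v w => Subtype.ext (map_add (nprod n u.1) v.1 w.1))
    fun u v => AddMonoidHom.ext fun w =>
      Subtype.ext (DFunLike.congr_fun (map_add (nprod n) u.1 v.1) w.1)
  vac := ⟨vac, by rw [LinearMap.mem_eqLocus, map_vac, map_vac]⟩
  regularity u v := by
    obtain ⟨N, hN⟩ := regularity u.1 v.1
    exact ⟨N, fun n hn => Subtype.ext (hN n hn)⟩
  creation_of_nonneg v n hn := Subtype.ext (creation_of_nonneg v.1 n hn)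
  creation_neg_one v := Subtype.ext (creation_neg_one v.1)
  jacobi u v w l m n := by
    -- The Jacobi sums are `finsum`s. An injective additive map commutes with these without any
    -- finiteness hypothesis, so the identity is inherited from V.
    let i : EqLocus f g →+ V :=
      (LinearMap.eqLocus f.toLinearMap g.toLinearMap).subtype.toAddMonoidHom
    have hi : Function.Injective i := Subtype.val_injective
    apply hi
    rw [AddMonoidHom.map_finsum_of_injective i hi, AddMonoidHom.map_finsum_of_injective i hi]
    simp only [map_zsmul, map_sub]
    exact jacobi u.1 v.1 w.1 l m n

instance instVertexAlgebra [VertexAlgebra R V] : VertexAlgebra R (EqLocus f g) where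
  nprod_smul_vac r s n := Subtype.ext (nprod_smul_vac (V := V) r s n)
  smul_vac_mem_center r u w m n :=
    Subtype.ext (smul_vac_mem_center (V := V) r u.1 w.1 m n)
  smul_eq_nprod r v := Subtype.ext (smul_eq_nprod r v.1)

end EqLocus

/-- The inclusion of the equalizer. -/
def eqLocusSubtype (f g : VertexAlgHom R V W) : VertexAlgHom R (EqLocus f g) V where
  toLinearMap := (LinearMap.eqLocus f.toLinearMap g.toLinearMap).subtype
  map_vac' := rfl
  map_nprod' _ _ _ := rfl

/-- The factorization through the equalizer of a homomorphism that equalizes. -/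
def eqLocusLift (f g : VertexAlgHom R V W) (h : VertexAlgHom R U V) (hh : f.comp h = g.comp h) :
    VertexAlgHom R U (EqLocus f g) where
  toLinearMap := h.toLinearMap.codRestrict (LinearMap.eqLocus f.toLinearMap g.toLinearMap)
    fun u => LinearMap.congr_fun (congrArg toLinearMap hh) u
  map_vac' := Subtype.ext h.map_vac'
  map_nprod' n u v := Subtype.ext (h.map_nprod' n u v)

/-- Presents the equalizer as a kernel, the form in which flatness shows that it commutes with S ⊗
-. -/
theorem exact_eqLocusSubtype (f g : VertexAlgHom R V W) :
    Function.Exact (eqLocusSubtype f g).toLinearMap (f.toLinearMap - g.toLinearMap) := fun v => by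
  rw [LinearMap.sub_apply, sub_eq_zero]
  exact ⟨fun h => ⟨⟨v, h⟩, rfl⟩, by rintro ⟨w, rfl⟩; exact w.2⟩

end EqLocus

theorem comp_toLinearMap_apply {R U V W : Type*} [CommRing R] [CommVertexRing R]
    [AddCommGroup U] [VertexRing U] [Module R U] [AddCommGroup V] [VertexRing V] [Module R V]
    [AddCommGroup W] [VertexRing W] [Module R W] (g : VertexAlgHom R V W) (f : VertexAlgHom R U V)
    (u : U) : (g.comp f).toLinearMap u = g.toLinearMap (f.toLinearMap u) := rfl

end VertexAlgHom

namespace VertexAlgEquiv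

/-- A bijective homomorphism is an isomorphism. -/
noncomputable def ofBijective {R V W : Type*} [CommRing R] [CommVertexRing R]
    [AddCommGroup V] [VertexRing V] [Module R V] [AddCommGroup W] [VertexRing W] [Module R W]
    (f : VertexAlgHom R V W) (hf : Function.Bijective f.toLinearMap) : VertexAlgEquiv R V W where
  toLinearEquiv := LinearEquiv.ofBijective f.toLinearMap hf
  map_vac' := f.map_vac'
  map_nprod' := f.map_nprod'

end VertexAlgEquiv

/-! ### Pushforward along S → T, multiplication maps and the cocycle condition. -/

namespace VertexDescent

open VertexRing VertexAlgHom

variable {R S T V W : Type*} [CommRing R] [CommVertexRing R]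
  [CommRing S] [CommVertexRing S] [Algebra R S] [VertexAlgebra R S]
  [CommRing T] [CommVertexRing T] [Algebra R T] [VertexAlgebra R T]
  [AddCommGroup V] [VertexRing V] [Module R V] [VertexAlgebra R V]
  [AddCommGroup W] [VertexRing W] [Module R W] [VertexAlgebra R W]

/-- The map `f ⊗ id` from `S ⊗ V` to `T ⊗ V`. -/
noncomputable abbrev pushforward (V : Type*) [AddCommGroup V] [VertexRing V] [Module R V]
    [VertexAlgebra R V] (f : VertexAlgHom R S T) : VertexAlgHom R (S ⊗[R] V) (T ⊗[R] V) :=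
  tensorMap f (VertexAlgHom.id R V)

theorem pushforward_tmul (f : VertexAlgHom R S T) (s : S) (v : V) :
    (pushforward V f).toLinearMap (s ⊗ₜ v) = f.toLinearMap s ⊗ₜ v := rfl

theorem pushforward_pushforward {T' : Type*} [CommRing T'] [CommVertexRing T'] [Algebra R T']
    [VertexAlgebra R T'] (g : VertexAlgHom R T T') (f : VertexAlgHom R S T) (x : S ⊗[R] V) :
    (pushforward V g).toLinearMap ((pushforward V f).toLinearMap x) =
      (pushforward V (g.comp f)).toLinearMap x := by
  induction x with
  | zero => simp
  | add x y hx hy => simp only [map_add, hx, hy]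
  | tmul s v => rfl

variable (R S) in
/-- The multiplication `S ⊗ S → S`. -/
noncomputable def mulHom : VertexAlgHom R (S ⊗[R] S) S :=
  -- With S regarded as a vertex algebra over itself, multiplication is the S-linear extension of
  -- the identity; that it respects all n-th products then needs no separate check.
  (liftBaseChange S (VertexAlgHom.id R S)).restrictScalars R

theorem mulHom_tmul (s t : S) : (mulHom R S).toLinearMap (s ⊗ₜ t) = s * t :=
  LinearMap.liftBaseChange_tmul ..

theorem mulHom_comp_inl : (mulHom R S).comp (inl R S S) = VertexAlgHom.id R S := by
  ext s
  exact (mulHom_tmul s 1).trans (mul_one s)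

variable (R S) in
/-- The multiplication `S ⊗ S ⊗ S → S`. -/
noncomputable def mulHom₃ : VertexAlgHom R (S ⊗[R] (S ⊗[R] S)) S :=
  (mulHom R S).comp (tensorMap (VertexAlgHom.id R S) (mulHom R S))

theorem mulHom₃_tmul (s t u : S) :
    (mulHom₃ R S).toLinearMap (s ⊗ₜ (t ⊗ₜ u)) = s * (t * u) := by
  change (mulHom R S).toLinearMap (s ⊗ₜ ((mulHom R S).toLinearMap (t ⊗ₜ u))) = _
  rw [mulHom_tmul, mulHom_tmul]

theorem tensor_ext {f g : VertexAlgHom R (S ⊗[R] T) V}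
    (h : ∀ s t, f.toLinearMap (s ⊗ₜ t) = g.toLinearMap (s ⊗ₜ t)) : f = g :=
  VertexAlgHom.toLinearMap_injective (TensorProduct.ext' h)

/-- The cocycle condition `d¹φ = d⁰φ ∘ d²φ` over `S ⊗ S ⊗ S`, with the cofaces spelled out. -/
def IsCocycle (φ : VertexAlgHom (S ⊗[R] S) ((S ⊗[R] S) ⊗[R] V) ((S ⊗[R] S) ⊗[R] V)) : Prop :=
  baseChange (tensorMap (VertexAlgHom.id R S) (inr R S S)) φ =
    (baseChange (inr R S (S ⊗[R] S)) φ).comp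
      (baseChange (tensorMap (VertexAlgHom.id R S) (inl R S S)) φ)

/-- Multiplying the three copies of S turns each of the three cofaces S ⊗ S → S ⊗ S ⊗ S into the
multiplication. The cocycle condition thus becomes φ' = φ' ∘ φ' for the base change φ' of φ along
multiplication, and φ' is invertible. -/
theorem baseChange_mulHom_of_isCocycle
    {φ : VertexAlgEquiv (S ⊗[R] S) ((S ⊗[R] S) ⊗[R] V) ((S ⊗[R] S) ⊗[R] V)}
    (hφ : IsCocycle φ.toHom) : baseChange (mulHom R S) φ.toHom = VertexAlgHom.id S (S ⊗[R] V) := by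
  have h := congrArg (baseChange (mulHom₃ R S)) hφ
  have e1 : (mulHom₃ R S).comp (tensorMap (VertexAlgHom.id R S) (inr R S S)) = mulHom R S :=
    tensor_ext fun s t => (mulHom₃_tmul s 1 t).trans (by rw [one_mul, mulHom_tmul])
  have e0 : (mulHom₃ R S).comp (inr R S (S ⊗[R] S)) = mulHom R S :=
    tensor_ext fun s t => (mulHom₃_tmul 1 s t).trans (by rw [one_mul, mulHom_tmul])
  have e2 : (mulHom₃ R S).comp (tensorMap (VertexAlgHom.id R S) (inl R S S)) = mulHom R S :=
    tensor_ext fun s t => (mulHom₃_tmul s t 1).trans (by rw [mul_one, mulHom_tmul])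
  rw [baseChange_comp, ← baseChange_comp_left, ← baseChange_comp_left, ← baseChange_comp_left,
    e0, e1, e2] at h
  ext x
  have hx := LinearMap.congr_fun (congrArg VertexAlgHom.toLinearMap h) x
  exact ((VertexAlgEquiv.baseChange (mulHom R S) φ).toLinearEquiv.injective hx).symm

/-! ### The descended algebra and the coaction of a cocycle. -/

/-- The first map `x ↦ φ(d¹x)` of the pair whose equalizer is the descended algebra. -/
noncomputable def twistedInl
    (φ : VertexAlgHom (S ⊗[R] S) ((S ⊗[R] S) ⊗[R] V) ((S ⊗[R] S) ⊗[R] V)) :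
    VertexAlgHom R (S ⊗[R] V) ((S ⊗[R] S) ⊗[R] V) :=
  (φ.restrictScalars R).comp (pushforward V (inl R S S))

theorem twistedInl_apply (φ : VertexAlgHom (S ⊗[R] S) ((S ⊗[R] S) ⊗[R] V) ((S ⊗[R] S) ⊗[R] V))
    (x : S ⊗[R] V) : (twistedInl φ).toLinearMap x =
      φ.toLinearMap ((pushforward V (inl R S S)).toLinearMap x) := rfl

/-- The descended algebra: those `x` in `S ⊗ V` with `φ(d¹x) = d⁰x`. -/
abbrev Descended
    (φ : VertexAlgHom (S ⊗[R] S) ((S ⊗[R] S) ⊗[R] V) ((S ⊗[R] S) ⊗[R] V)) : Type _ :=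
  EqLocus (twistedInl φ) (pushforward V (inr R S S))

/-- The inclusion of the descended algebra into `S ⊗ V`. -/
noncomputable abbrev descendedSubtype
    (φ : VertexAlgHom (S ⊗[R] S) ((S ⊗[R] S) ⊗[R] V) ((S ⊗[R] S) ⊗[R] V)) :
    VertexAlgHom R (Descended φ) (S ⊗[R] V) :=
  eqLocusSubtype (twistedInl φ) (pushforward V (inr R S S))

/-- The coaction `x ↦ φ(d¹x)` with values in `S ⊗ (S ⊗ V)`. -/
noncomputable def coaction
    (φ : VertexAlgHom (S ⊗[R] S) ((S ⊗[R] S) ⊗[R] V) ((S ⊗[R] S) ⊗[R] V)) :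
    S ⊗[R] V →ₗ[R] S ⊗[R] (S ⊗[R] V) :=
  (TensorProduct.assoc R S S V).toLinearMap ∘ₗ (twistedInl φ).toLinearMap

theorem coaction_apply (φ : VertexAlgHom (S ⊗[R] S) ((S ⊗[R] S) ⊗[R] V) ((S ⊗[R] S) ⊗[R] V))
    (x : S ⊗[R] V) : coaction φ x = TensorProduct.assoc R S S V
      (φ.toLinearMap ((pushforward V (inl R S S)).toLinearMap x)) := rfl

/-- The coface d¹ places s in the outer copy of S, through which S acts on S ⊗ (S ⊗ V). -/
theorem assoc_inl_smul (s : S) (z : (S ⊗[R] S) ⊗[R] V) :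
    TensorProduct.assoc R S S V ((inl R S S).toLinearMap s • z) =
      s • TensorProduct.assoc R S S V z := by
  induction z with
  | zero => simp
  | add x y hx hy => simp only [smul_add, map_add, hx, hy]
  | tmul p v =>
    induction p with
    | zero => simp
    | add x y hx hy => simp only [TensorProduct.add_tmul, smul_add, map_add, hx, hy]
    | tmul a b =>
      change TensorProduct.assoc R S S V ((s ⊗ₜ[R] (1 : S)) • ((a ⊗ₜ[R] b) ⊗ₜ[R] v)) = _
      simp [TensorProduct.smul_tmul']

/-- The pushforward along `inl` is semilinear and φ is linear over S ⊗ S. So the S-action on S ⊗ V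
goes to the action on the outer factor only. -/
theorem coaction_smul (φ : VertexAlgHom (S ⊗[R] S) ((S ⊗[R] S) ⊗[R] V) ((S ⊗[R] S) ⊗[R] V))
    (s : S) (x : S ⊗[R] V) : coaction φ (s • x) = s • coaction φ x := by
  rw [coaction_apply, coaction_apply, tensorMap_smul, map_smul, assoc_inl_smul]

/-- For f = `inl` or `inr` the pushforward on the right is along the coface d² or d¹ of S ⊗ S. This
and `lTensor_assoc` translate maps id ⊗ (-) on S ⊗ (S ⊗ V) into the language of cofaces. -/
theorem lTensor_pushforward_assoc {T₁ T₂ : Type*} [CommRing T₁] [CommVertexRing T₁] [Algebra R T₁]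
    [VertexAlgebra R T₁] [CommRing T₂] [CommVertexRing T₂] [Algebra R T₂]
    [VertexAlgebra R T₂] (f : VertexAlgHom R T₁ T₂) (z : (S ⊗[R] T₁) ⊗[R] V) :
    (pushforward V f).toLinearMap.lTensor S (TensorProduct.assoc R S T₁ V z) =
      TensorProduct.assoc R S T₂ V
        ((pushforward V (tensorMap (VertexAlgHom.id R S) f)).toLinearMap z) := by
  induction z with
  | zero => simp
  | add x y hx hy => simp only [map_add, hx, hy]
  | tmul p v =>
    induction p with
    | zero => simp
    | add x y hx hy => simp only [TensorProduct.add_tmul, map_add, hx, hy]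
    | tmul a b => rfl

theorem assoc_tmul_smul_pushforward_inr (a : S) (p : T) (y : T ⊗[R] V) :
    TensorProduct.assoc R S T V ((a ⊗ₜ[R] p) • (pushforward V (inr R S T)).toLinearMap y) =
      a ⊗ₜ (p • y) := by
  induction y with
  | zero => simp
  | add x y hx hy => simp only [map_add, smul_add, TensorProduct.tmul_add, hx, hy]
  | tmul q v =>
    change TensorProduct.assoc R S T V ((a ⊗ₜ[R] p) • (((1 : S) ⊗ₜ[R] q) ⊗ₜ[R] v)) = _
    simp [TensorProduct.smul_tmul']

/-- For T = S ⊗ S, base change along `inr` is the coface d⁰: applying φ to the inner factors is d⁰φ.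
-/
theorem lTensor_assoc (φ : VertexAlgHom T (T ⊗[R] V) (T ⊗[R] W)) (z : (S ⊗[R] T) ⊗[R] V) :
    (φ.restrictScalars R).toLinearMap.lTensor S (TensorProduct.assoc R S T V z) =
      TensorProduct.assoc R S T W ((baseChange (inr R S T) φ).toLinearMap z) := by
  induction z with
  | zero => simp
  | add x y hx hy => simp only [map_add, hx, hy]
  | tmul p v =>
    induction p with
    | zero => simp
    | add x y hx hy => simp only [TensorProduct.add_tmul, map_add, hx, hy]
    | tmul a b =>
      rw [baseChange_tmul, assoc_tmul_smul_pushforward_inr, TensorProduct.assoc_tmul,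
        LinearMap.lTensor_tmul, ← map_smul, TensorProduct.smul_tmul', smul_eq_mul, mul_one]
      rfl

/-- After reassociation the left side is d⁰φ(d²φ(d²d¹x)) and the right side is d¹φ(d¹d¹x). The outer
maps agree by the cocycle condition. -/
theorem coaction_coassoc {φ : VertexAlgHom (S ⊗[R] S) ((S ⊗[R] S) ⊗[R] V) ((S ⊗[R] S) ⊗[R] V)}
    (hφ : IsCocycle φ) (x : S ⊗[R] V) :
    (twistedInl φ).toLinearMap.lTensor S (coaction φ x) =
      (pushforward V (inr R S S)).toLinearMap.lTensor S (coaction φ x) := by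
  have h : (twistedInl φ).toLinearMap = (φ.restrictScalars R).toLinearMap ∘ₗ
    (pushforward V (inl R S S)).toLinearMap := rfl
  rw [coaction_apply, h, LinearMap.lTensor_comp_apply, lTensor_pushforward_assoc,
    lTensor_pushforward_assoc, lTensor_assoc, ← baseChange_tensorMap, ← baseChange_tensorMap,
    hφ, pushforward_pushforward, pushforward_pushforward]
  -- The cofaces satisfy d²d¹ = d¹d¹ on S: both composites are s ↦ s ⊗ 1 ⊗ 1.
  rfl

/-- The contraction s ⊗ x ↦ s • x of S ⊗ (S ⊗ V) multiplies the two copies of S. -/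
theorem liftBaseChange_id_assoc (z : (S ⊗[R] S) ⊗[R] V) :
    (LinearMap.id (R := R) (M := S ⊗[R] V)).liftBaseChange S (TensorProduct.assoc R S S V z) =
      (pushforward V (mulHom R S)).toLinearMap z := by
  induction z with
  | zero => simp
  | add x y hx hy => simp only [map_add, hx, hy]
  | tmul p v =>
    induction p with
    | zero => simp
    | add x y hx hy => simp only [TensorProduct.add_tmul, map_add, hx, hy]
    | tmul a b =>
      rw [pushforward_tmul, mulHom_tmul, TensorProduct.assoc_tmul, LinearMap.liftBaseChange_tmul,
        LinearMap.id_apply, TensorProduct.smul_tmul', smul_eq_mul]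

/-- Counit law: contracting φ(d¹x) applies to x the base change of φ along multiplication, which is
the identity, because multiplication undoes d¹. -/
theorem liftBaseChange_id_coaction
    {φ : VertexAlgEquiv (S ⊗[R] S) ((S ⊗[R] S) ⊗[R] V) ((S ⊗[R] S) ⊗[R] V)}
    (hφ : IsCocycle φ.toHom) (x : S ⊗[R] V) :
    (LinearMap.id (R := R) (M := S ⊗[R] V)).liftBaseChange S (coaction φ.toHom x) = x := by
  rw [coaction_apply, liftBaseChange_id_assoc, ← baseChange_tensorMap,
    baseChange_mulHom_of_isCocycle hφ, pushforward_pushforward, mulHom_comp_inl]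
  exact LinearMap.congr_fun TensorProduct.map_id x

theorem liftBaseChange_lTensor {M N : Type*} [AddCommGroup M] [Module R M] [AddCommGroup N]
    [Module R N] (f : M →ₗ[R] S ⊗[R] N) (y : S ⊗[R] M) :
    (LinearMap.id (R := R) (M := S ⊗[R] N)).liftBaseChange S (f.lTensor S y) =
      f.liftBaseChange S y := by
  induction y with
  | zero => simp
  | add x y hx hy => simp only [map_add, hx, hy]
  | tmul s m => simp

/-- On w in the descended algebra, Δ(w) is d⁰w, that is 1 ⊗ w; linearity in the outer factor then
gives Δ(s • w) = s ⊗ w. So Δ ∘ θ is the inclusion S ⊗ W → S ⊗ (S ⊗ V). -/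
theorem coaction_liftBaseChange
    (φ : VertexAlgHom (S ⊗[R] S) ((S ⊗[R] S) ⊗[R] V) ((S ⊗[R] S) ⊗[R] V))
    (y : S ⊗[R] Descended φ) :
    coaction φ ((liftBaseChange S (descendedSubtype φ)).toLinearMap y) =
      (descendedSubtype φ).toLinearMap.lTensor S y := by
  induction y with
  | zero => simp
  | add x y hx hy => simp only [map_add, hx, hy]
  | tmul s w =>
    have h : (liftBaseChange S (descendedSubtype φ)).toLinearMap (s ⊗ₜ w) = s • w.1 :=
      LinearMap.liftBaseChange_tmul ..
    -- With both scalars equal to 1 this identifies d⁰w with 1 ⊗ w.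
    have h1 := assoc_tmul_smul_pushforward_inr (1 : S) (1 : S) w.1
    rw [← Algebra.TensorProduct.one_def, one_smul, one_smul] at h1
    rw [h, coaction_smul, coaction_apply, ← twistedInl_apply, w.apply_val, h1,
      TensorProduct.smul_tmul', smul_eq_mul, mul_one]
    rfl

/-! ### Descent of vertex algebras. -/

/-- Faithfully flat descent along a cocycle. -/
theorem bijective_liftBaseChange_descendedSubtype [Module.Flat R S]
    {φ : VertexAlgEquiv (S ⊗[R] S) ((S ⊗[R] S) ⊗[R] V) ((S ⊗[R] S) ⊗[R] V)}
    (hφ : IsCocycle φ.toHom) :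
    Function.Bijective (liftBaseChange S (descendedSubtype φ.toHom)).toLinearMap := by
  constructor
  · intro y y' h
    -- Applying Δ turns θ into S ⊗ (inclusion of W), which is injective by flatness.
    apply Module.Flat.lTensor_preserves_injective_linearMap (M := S)
      (descendedSubtype φ.toHom).toLinearMap Subtype.val_injective
    rw [← coaction_liftBaseChange, h, coaction_liftBaseChange]
  · intro x
    -- S ⊗ - preserves the kernel defining W, and Δ(x) lies in the kernel so obtained; hence Δ(x)
    -- comes from some y in S ⊗ W.
    have hex := Module.Flat.lTensor_exact S
      (exact_eqLocusSubtype (twistedInl φ.toHom) (pushforward V (inr R S S)))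
    obtain ⟨y, hy⟩ := (hex (coaction φ.toHom x)).mp (by
      rw [LinearMap.lTensor_sub, LinearMap.sub_apply, sub_eq_zero, coaction_coassoc hφ])
    refine ⟨y, ?_⟩
    -- Contraction restricted to S ⊗ W is θ, and it sends Δ(x) to x; therefore θ(y) = x.
    have h := liftBaseChange_lTensor (descendedSubtype φ.toHom).toLinearMap y
    rw [hy, liftBaseChange_id_coaction hφ] at h
    exact h.symm

/-! ### The Amitsur complex and descent of homomorphisms. -/

theorem isCocycle_id : IsCocycle (VertexAlgHom.id (S ⊗[R] S) ((S ⊗[R] S) ⊗[R] V)) := by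
  rw [IsCocycle, baseChange_id, baseChange_id, baseChange_id]
  rfl

theorem pushforward_inr_one_tmul (v : V) :
    (pushforward V (inr R S S)).toLinearMap (1 ⊗ₜ v) =
      (pushforward V (inl R S S)).toLinearMap (1 ⊗ₜ v) := rfl

/-- Exactness of the Amitsur complex `V → S ⊗ V ⇉ S ⊗ S ⊗ V` for faithfully flat `S`. -/
theorem exists_one_tmul_eq [Module.FaithfullyFlat R S] {x : S ⊗[R] V}
    (hx : (pushforward V (inl R S S)).toLinearMap x = (pushforward V (inr R S S)).toLinearMap x) :
    ∃ v : V, 1 ⊗ₜ v = x := by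
  -- For the identity cocycle the descended algebra is the equalizer of d¹ and d⁰ themselves, and v
  -- ↦ 1 ⊗ v factors through it as `j`.
  let ι := VertexAlgEquiv.refl (S ⊗[R] S) ((S ⊗[R] S) ⊗[R] V)
  let j : VertexAlgHom R V (Descended ι.toHom) :=
    eqLocusLift _ _ (inr R S V) (VertexAlgHom.ext fun v => (pushforward_inr_one_tmul v).symm)
  have hι : IsCocycle ι.toHom := isCocycle_id
  have hb := bijective_liftBaseChange_descendedSubtype hι
  have hj : ∀ y, (liftBaseChange S (descendedSubtype ι.toHom)).toLinearMap
      (j.toLinearMap.lTensor S y) = y := fun y => by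
    induction y with
    | zero => simp
    | add x y hx hy => simp only [map_add, hx, hy]
    | tmul s v =>
      refine (LinearMap.liftBaseChange_tmul ..).trans ?_
      change s • ((1 : S) ⊗ₜ[R] v) = _
      rw [TensorProduct.smul_tmul', smul_eq_mul, mul_one]
  -- θ ∘ (S ⊗ j) is the identity of S ⊗ V and θ is bijective, so S ⊗ j is bijective. Faithful
  -- flatness then removes S ⊗ -.
  have hj' : Function.Bijective (j.toLinearMap.lTensor S) :=
    (Function.Bijective.of_comp_iff' hb _).mp ((funext hj : _ ∘ _ = _root_.id) ▸
      Function.bijective_id)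
  obtain ⟨v, hv⟩ :=
    ((Module.FaithfullyFlat.lTensor_bijective_iff_bijective R S j.toLinearMap).mp hj').2 ⟨x, hx⟩
  exact ⟨v, congrArg Subtype.val hv⟩

/-- A homomorphism `S ⊗ V → S ⊗ W` with equal base changes along the two cofaces is defined
over `R`. -/
theorem exists_eq_tensorMap_id [Module.FaithfullyFlat R S]
    (ψ : VertexAlgHom S (S ⊗[R] V) (S ⊗[R] W))
    (hψ : baseChange (inl R S S) ψ = baseChange (inr R S S) ψ) :
    ∃ f : VertexAlgHom R V W, ∀ v, (1 : S) ⊗ₜ[R] f.toLinearMap v = ψ.toLinearMap (1 ⊗ₜ v) := by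
  have h : ∀ v : V, ∃ w : W, (1 : S) ⊗ₜ[R] w = ψ.toLinearMap (1 ⊗ₜ v) := fun v =>
    exists_one_tmul_eq (by
      -- d¹(ψ(1 ⊗ v)) is d¹ψ applied to d¹(1 ⊗ v), and likewise for d⁰. The two arguments coincide
      -- because both cofaces send 1 to 1 ⊗ 1.
      rw [← baseChange_tensorMap, ← baseChange_tensorMap, hψ]
      rfl)
  have hinj : Function.Injective fun w : W => (1 : S) ⊗ₜ[R] w :=
    Module.FaithfullyFlat.tensorProduct_mk_injective W
  choose f hf using h
  -- Each law for f holds after the injection w ↦ 1 ⊗ w, where it becomes the same law for ψ.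
  refine ⟨⟨⟨⟨f, fun v w => hinj ?_⟩, fun r v => hinj ?_⟩, hinj ?_, fun n u v => hinj ?_⟩, hf⟩
  · simp only [TensorProduct.tmul_add, hf, map_add]
  · simp only [TensorProduct.tmul_smul, hf, RingHom.id_apply]
    exact (ψ.toLinearMap.restrictScalars R).map_smul r _
  · exact (hf _).trans ψ.map_vac
  · change (1 : S) ⊗ₜ[R] f _ = 1 ⊗ₜ nprod n (f u) (f v)
    rw [hf, ← BaseChange.nprod_one_tmul, ← BaseChange.nprod_one_tmul, hf, hf, map_nprod]

/-- An isomorphism `S ⊗ V ≃ S ⊗ W` with equal base changes along the two cofaces descends. -/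
theorem nonempty_equiv_of_baseChange_eq [Module.FaithfullyFlat R S]
    (ψ : VertexAlgEquiv S (S ⊗[R] V) (S ⊗[R] W))
    (hψ : VertexAlgEquiv.baseChange (inl R S S) ψ = VertexAlgEquiv.baseChange (inr R S S) ψ) :
    Nonempty (VertexAlgEquiv R V W) := by
  obtain ⟨f, hf⟩ := exists_eq_tensorMap_id ψ.toHom (congrArg VertexAlgEquiv.toHom hψ)
  -- The inverse satisfies the same hypothesis, since base change commutes with inversion.
  obtain ⟨g, hg⟩ := exists_eq_tensorMap_id ψ.symm.toHom
    (congrArg (fun χ : VertexAlgEquiv _ _ _ => χ.symm.toHom) hψ)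
  have hV : Function.Injective fun v : V => (1 : S) ⊗ₜ[R] v :=
    Module.FaithfullyFlat.tensorProduct_mk_injective V
  have hW : Function.Injective fun w : W => (1 : S) ⊗ₜ[R] w :=
    Module.FaithfullyFlat.tensorProduct_mk_injective W
  refine ⟨VertexAlgEquiv.ofInverse f g (VertexAlgHom.ext fun v => hV ?_)
    (VertexAlgHom.ext fun w => hW ?_)⟩
  · change (1 : S) ⊗ₜ[R] g.toLinearMap (f.toLinearMap v) = 1 ⊗ₜ v
    rw [hg, hf]
    exact ψ.toLinearEquiv.symm_apply_apply _
  · change (1 : S) ⊗ₜ[R] f.toLinearMap (g.toLinearMap w) = 1 ⊗ₜ w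
    rw [hf, hg]
    exact ψ.toLinearEquiv.apply_symm_apply _

end VertexDescent

/-! ### Base change of composites and of isomorphisms defined over R. -/

theorem VertexAlgHom.liftBaseChange_one_tmul {R S V W : Type*} [CommRing R] [CommVertexRing R]
    [CommRing S] [CommVertexRing S] [Algebra R S] [VertexAlgebra R S]
    [AddCommGroup V] [VertexRing V] [Module R V] [VertexAlgebra R V]
    [AddCommGroup W] [VertexRing W] [Module R W] [Module S W] [IsScalarTower R S W]
    [VertexAlgebra S W] (g : VertexAlgHom R V W) (v : V) :
    (liftBaseChange S g).toLinearMap (1 ⊗ₜ v) = g.toLinearMap v :=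
  (LinearMap.liftBaseChange_tmul ..).trans (one_smul S _)

namespace VertexAlgEquiv

variable {R S T U V W : Type*} [CommRing R] [CommVertexRing R]
  [CommRing S] [CommVertexRing S] [Algebra R S] [VertexAlgebra R S]
  [CommRing T] [CommVertexRing T] [Algebra R T] [VertexAlgebra R T]
  [AddCommGroup U] [VertexRing U] [Module R U] [VertexAlgebra R U]
  [AddCommGroup V] [VertexRing V] [Module R V] [VertexAlgebra R V]
  [AddCommGroup W] [VertexRing W] [Module R W] [VertexAlgebra R W]

theorem baseChange_trans (f : VertexAlgHom R S T) (φ : VertexAlgEquiv S (S ⊗[R] U) (S ⊗[R] V))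
    (ψ : VertexAlgEquiv S (S ⊗[R] V) (S ⊗[R] W)) :
    VertexAlgEquiv.baseChange f (φ.trans ψ) =
      (VertexAlgEquiv.baseChange f φ).trans (VertexAlgEquiv.baseChange f ψ) :=
  toHom_injective (VertexAlgHom.baseChange_comp f ψ.toHom φ.toHom)

theorem baseChange_symm (f : VertexAlgHom R S T) (φ : VertexAlgEquiv S (S ⊗[R] V) (S ⊗[R] W)) :
    VertexAlgEquiv.baseChange f φ.symm = (VertexAlgEquiv.baseChange f φ).symm := rfl

theorem symm_trans (φ : VertexAlgEquiv R U V) (ψ : VertexAlgEquiv R V W) :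
    (φ.trans ψ).symm = ψ.symm.trans φ.symm := rfl

theorem trans_apply (φ : VertexAlgEquiv R U V) (ψ : VertexAlgEquiv R V W) (u : U) :
    (φ.trans ψ).toLinearEquiv u = ψ.toLinearEquiv (φ.toLinearEquiv u) := rfl

theorem symm_apply_apply (φ : VertexAlgEquiv R V W) (v : V) :
    φ.symm.toLinearEquiv (φ.toLinearEquiv v) = v := φ.toLinearEquiv.symm_apply_apply v

theorem apply_symm_apply (φ : VertexAlgEquiv R V W) (w : W) :
    φ.toLinearEquiv (φ.symm.toLinearEquiv w) = w := φ.toLinearEquiv.apply_symm_apply w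

/-- The isomorphism `id ⊗ f` from `S ⊗ V` to `S ⊗ W`. -/
noncomputable def extendScalars (S : Type*) [CommRing S] [CommVertexRing S] [Algebra R S]
    [VertexAlgebra R S] (f : VertexAlgEquiv R V W) : VertexAlgEquiv S (S ⊗[R] V) (S ⊗[R] W) :=
  ofInverse (VertexAlgHom.liftBaseChange S ((VertexAlgHom.inr R S W).comp f.toHom))
    (VertexAlgHom.liftBaseChange S ((VertexAlgHom.inr R S V).comp f.symm.toHom))
    (VertexAlgHom.ext_tmul fun v => by
      rw [VertexAlgHom.comp_toLinearMap_apply, VertexAlgHom.liftBaseChange_one_tmul]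
      exact (VertexAlgHom.liftBaseChange_one_tmul ..).trans
        (congrArg ((1 : S) ⊗ₜ[R] ·) (f.symm_apply_apply v)))
    (VertexAlgHom.ext_tmul fun w => by
      rw [VertexAlgHom.comp_toLinearMap_apply, VertexAlgHom.liftBaseChange_one_tmul]
      exact (VertexAlgHom.liftBaseChange_one_tmul ..).trans
        (congrArg ((1 : S) ⊗ₜ[R] ·) (f.apply_symm_apply w)))

theorem extendScalars_one_tmul (f : VertexAlgEquiv R V W) (v : V) :
    (extendScalars S f).toHom.toLinearMap (1 ⊗ₜ[R] v) = (1 : S) ⊗ₜ[R] f.toLinearEquiv v :=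
  VertexAlgHom.liftBaseChange_one_tmul ..

/-- An isomorphism defined over R has the same base change along both cofaces, so it cancels between
d⁰ and d¹. -/
theorem baseChange_extendScalars (g : VertexAlgHom R S T) (f : VertexAlgEquiv R V W) :
    VertexAlgEquiv.baseChange g (extendScalars S f) = extendScalars T f := by
  refine toHom_injective (VertexAlgHom.ext_tmul fun v => ?_)
  rw [toHom_baseChange, VertexAlgHom.baseChange_tmul, one_smul, extendScalars_one_tmul,
    extendScalars_one_tmul]
  exact congrArg (· ⊗ₜ[R] f.toLinearEquiv v) g.map_one

end VertexAlgEquiv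

/-! ### Comparison of forms with cohomology classes. -/

namespace VertexDescent

open VertexAlgHom

universe r u v

variable {R : Type r} [CommRing R] [CommVertexRing R]
  {S : Type u} [CommRing S] [CommVertexRing S] [Algebra R S] [VertexAlgebra R S]
  {V : Type v} [AddCommGroup V] [VertexRing V] [Module R V] [VertexAlgebra R V]
  {W W' : Type v} [AddCommGroup W] [VertexRing W] [Module R W] [VertexAlgebra R W]
  [AddCommGroup W'] [VertexRing W'] [Module R W'] [VertexAlgebra R W']

theorem mk_transitionCocycle_eq_iff {θ : VertexAlgEquiv S (S ⊗[R] W) (S ⊗[R] V)}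
    {θ' : VertexAlgEquiv S (S ⊗[R] W') (S ⊗[R] V)} :
    H1.mk R S (autFunctor R V) (transitionCocycle θ) =
        H1.mk R S (autFunctor R V) (transitionCocycle θ') ↔
      ∃ g : VertexAlgEquiv S (S ⊗[R] V) (S ⊗[R] V),
        transitionAut θ' = VertexAlgEquiv.baseChange (inr R S S) g * transitionAut θ *
          (VertexAlgEquiv.baseChange (inl R S S) g).symm :=
  ⟨fun h => Quotient.exact h, fun h => Quotient.sound (s := cocycleSetoid R S _) h⟩

theorem transitionAut_apply (θ : VertexAlgEquiv S (S ⊗[R] W) (S ⊗[R] V))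
    (x : (S ⊗[R] S) ⊗[R] V) :
    (transitionAut θ).toLinearEquiv x =
      (VertexAlgEquiv.baseChange (inr R S S) θ).toLinearEquiv
        ((VertexAlgEquiv.baseChange (inl R S S) θ).symm.toLinearEquiv x) := rfl

/-- Isomorphic forms have cohomologous cocycles, whatever the trivializations. -/
theorem mk_transitionCocycle_eq_of_equiv (θ : VertexAlgEquiv S (S ⊗[R] W) (S ⊗[R] V))
    (θ' : VertexAlgEquiv S (S ⊗[R] W') (S ⊗[R] V)) (f : VertexAlgEquiv R W W') :
    H1.mk R S (autFunctor R V) (transitionCocycle θ) =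
      H1.mk R S (autFunctor R V) (transitionCocycle θ') := by
  -- The witness is g = θ' ∘ (id ⊗ f) ∘ θ⁻¹.
  refine mk_transitionCocycle_eq_iff.mpr
    ⟨(θ.symm.trans (f.extendScalars S)).trans θ', VertexAlgEquiv.ext fun x => ?_⟩
  -- Writing x = d¹g(y) makes all the inverses cancel; both sides become d⁰θ' ∘ (id ⊗ f) ∘ (d¹θ)⁻¹
  -- at y.
  obtain ⟨y, rfl⟩ := (((VertexAlgEquiv.baseChange (inl R S S) θ).symm.trans
    (f.extendScalars (S ⊗[R] S))).trans
      (VertexAlgEquiv.baseChange (inl R S S) θ')).toLinearEquiv.surjective x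
  simp only [VertexAlgEquiv.baseChange_trans, VertexAlgEquiv.baseChange_symm,
    VertexAlgEquiv.baseChange_extendScalars, VertexAlgEquiv.mul_apply, transitionAut_apply,
    VertexAlgEquiv.symm_apply_apply, VertexAlgEquiv.trans_apply, VertexAlgEquiv.symm_trans]

/-- Forms with cohomologous cocycles are isomorphic. -/
theorem nonempty_equiv_of_mk_transitionCocycle_eq [Module.FaithfullyFlat R S]
    {θ : VertexAlgEquiv S (S ⊗[R] W) (S ⊗[R] V)} {θ' : VertexAlgEquiv S (S ⊗[R] W') (S ⊗[R] V)}
    (h : H1.mk R S (autFunctor R V) (transitionCocycle θ) =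
      H1.mk R S (autFunctor R V) (transitionCocycle θ')) :
    Nonempty (VertexAlgEquiv R W W') := by
  obtain ⟨g, hg⟩ := mk_transitionCocycle_eq_iff.mp h
  -- The candidate is ψ = θ'⁻¹ ∘ g ∘ θ; the relation between the two cocycles is a rearrangement of
  -- d¹ψ = d⁰ψ.
  refine nonempty_equiv_of_baseChange_eq ((θ.trans g).trans θ'.symm)
    (VertexAlgEquiv.ext fun x => ?_)
  -- Evaluating at d¹g(d¹θ(x)) clears the inverses from the right side and leaves d⁰θ'(d¹ψ(x)) =
  -- d⁰g(d⁰θ(x)).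
  have hx := congrArg (fun χ : VertexAlgEquiv _ _ _ => χ.toLinearEquiv
    (((VertexAlgEquiv.baseChange (inl R S S) θ).trans
      (VertexAlgEquiv.baseChange (inl R S S) g)).toLinearEquiv x)) hg
  simp only [VertexAlgEquiv.mul_apply, transitionAut_apply, VertexAlgEquiv.symm_apply_apply,
    VertexAlgEquiv.trans_apply] at hx
  simp only [VertexAlgEquiv.baseChange_trans, VertexAlgEquiv.baseChange_symm,
    VertexAlgEquiv.trans_apply]
  rw [← hx, VertexAlgEquiv.symm_apply_apply]

theorem transitionCocycle_refl :
    transitionCocycle (VertexAlgEquiv.refl S (S ⊗[R] V)) = 1 := by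
  have h (f : VertexAlgHom R S (S ⊗[R] S)) :
      VertexAlgEquiv.baseChange f (VertexAlgEquiv.refl S (S ⊗[R] V)) =
        VertexAlgEquiv.refl (S ⊗[R] S) ((S ⊗[R] S) ⊗[R] V) :=
    VertexAlgEquiv.toHom_injective (baseChange_id f)
  refine Subtype.ext ?_
  change (VertexAlgEquiv.baseChange (inl R S S) _).symm.trans
    (VertexAlgEquiv.baseChange (inr R S S) _) = _
  rw [h, h]
  rfl

/-- The trivialization θ of the descended algebra has φ as its transition automorphism: the equation
φ(d¹w) = d⁰w on W extends linearly to φ ∘ d¹θ = d⁰θ. -/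
theorem transitionAut_ofBijective
    {φ : VertexAlgEquiv (S ⊗[R] S) ((S ⊗[R] S) ⊗[R] V) ((S ⊗[R] S) ⊗[R] V)}
    (hb : Function.Bijective (liftBaseChange S (descendedSubtype φ.toHom)).toLinearMap) :
    (VertexAlgEquiv.baseChange (inl R S S) (VertexAlgEquiv.ofBijective _ hb)).symm.trans
      (VertexAlgEquiv.baseChange (inr R S S) (VertexAlgEquiv.ofBijective _ hb)) = φ := by
  have h : φ.toHom.comp (baseChange (inl R S S) (liftBaseChange S (descendedSubtype φ.toHom))) =
      baseChange (inr R S S) (liftBaseChange S (descendedSubtype φ.toHom)) := by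
    refine ext_tmul fun w => ?_
    rw [comp_toLinearMap_apply, baseChange_tmul, baseChange_tmul, one_smul, one_smul,
      liftBaseChange_one_tmul]
    exact w.apply_val
  refine VertexAlgEquiv.ext fun x => ?_
  obtain ⟨y, rfl⟩ := (VertexAlgEquiv.baseChange (inl R S S)
    (VertexAlgEquiv.ofBijective _ hb)).toLinearEquiv.surjective x
  rw [VertexAlgEquiv.trans_apply, VertexAlgEquiv.symm_apply_apply]
  exact (LinearMap.congr_fun (congrArg VertexAlgHom.toLinearMap h) y).symm

end VertexDescent

-- The bijection between forms and cohomology.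

universe r u v

/-- The form is the descended algebra, and flatness suffices. It is carved out of S ⊗ V, so V is
placed in a universe containing that of S to let the form live in the universe of V. -/
theorem VertexDescent.exists_transitionCocycle_eq {R : Type r} [CommRing R] [CommVertexRing R]
    {S : Type u} [CommRing S] [CommVertexRing S] [Algebra R S] [VertexAlgebra R S]
    [Module.Flat R S]
    {V : Type (max u v)} [AddCommGroup V] [VertexRing V] [Module R V] [VertexAlgebra R V]
    (φ : Cocycle R S (autFunctor R V)) :
    ∃ (W : TwistedForm R S V) (θ : VertexAlgEquiv S (S ⊗[R] W.carrier) (S ⊗[R] V)),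
      transitionCocycle θ = φ := by
  let φ₁ : VertexAlgEquiv (S ⊗[R] S) ((S ⊗[R] S) ⊗[R] V) ((S ⊗[R] S) ⊗[R] V) := φ.val
  have hφ : IsCocycle φ₁.toHom := congrArg VertexAlgEquiv.toHom φ.property
  let θ := VertexAlgEquiv.ofBijective _ (bijective_liftBaseChange_descendedSubtype hφ)
  exact ⟨⟨Descended φ₁.toHom, ⟨θ⟩⟩, θ, Subtype.ext (transitionAut_ofBijective _)⟩

theorem mainTheorem5 {R : Type r} [CommRing R] [CommVertexRing R]
    {S : Type u} [CommRing S] [CommVertexRing S] [Algebra R S] [VertexAlgebra R S]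
    [Module.FaithfullyFlat R S]
    {V : Type (max u v)} [AddCommGroup V] [VertexRing V] [Module R V] [VertexAlgebra R V] :
    ∃ e : VertexDescent.FormClasses R S V ≃ VertexDescent.H1 R S (VertexDescent.autFunctor R V),
      e (VertexDescent.FormClasses.mk R S V (VertexDescent.TwistedForm.self R S V)) = 1 ∧
      ∀ (W : VertexDescent.TwistedForm R S V)
        (θ : VertexAlgEquiv S (TensorProduct R S W.carrier) (TensorProduct R S V)),
        e (VertexDescent.FormClasses.mk R S V W) =
          VertexDescent.H1.mk R S (VertexDescent.autFunctor R V)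
            (VertexDescent.transitionCocycle θ) := by
  let c : VertexDescent.FormClasses R S V →
      VertexDescent.H1 R S (VertexDescent.autFunctor R V) :=
    -- The trivialization is chosen arbitrarily; isomorphic forms give the same class for any
    -- choices.
    Quotient.lift (fun W => VertexDescent.H1.mk R S (VertexDescent.autFunctor R V)
      (VertexDescent.transitionCocycle W.isForm.some))
      fun W W' ⟨f⟩ => VertexDescent.mk_transitionCocycle_eq_of_equiv _ _ f
  have hc : ∀ (W : VertexDescent.TwistedForm R S V)
      (θ : VertexAlgEquiv S (TensorProduct R S W.carrier) (TensorProduct R S V)),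
      c (VertexDescent.FormClasses.mk R S V W) =
        VertexDescent.H1.mk R S (VertexDescent.autFunctor R V)
          (VertexDescent.transitionCocycle θ) := fun W θ =>
    -- The identity of W compares the chosen trivialization with θ.
    VertexDescent.mk_transitionCocycle_eq_of_equiv _ θ (VertexAlgEquiv.refl R _)
  refine ⟨Equiv.ofBijective c ⟨?_, ?_⟩, ?_, hc⟩
  · rintro ⟨W⟩ ⟨W'⟩ h
    exact Quotient.sound (s := VertexDescent.twistedFormSetoid R S V)
      (VertexDescent.nonempty_equiv_of_mk_transitionCocycle_eq h)
  · rintro ⟨φ⟩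
    obtain ⟨W, θ, rfl⟩ := VertexDescent.exists_transitionCocycle_eq φ
    exact ⟨VertexDescent.FormClasses.mk R S V W, hc W θ⟩
  -- Trivializing V by the identity yields the trivial cocycle on the nose.
  · exact (hc (VertexDescent.TwistedForm.self R S V) (VertexAlgEquiv.refl S _)).trans
      (congrArg (VertexDescent.H1.mk R S (VertexDescent.autFunctor R V))
        VertexDescent.transitionCocycle_refl)
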